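/- Let $M = S^1\times S^2$, where $S^1\subset\mathbb C$ is the unit circle with coordinate $e^{\mathbf{i}\theta}$ and $S^2\subset\mathbb R^3$ is the unit sphere with coordinates $y_1,y_2,y_3$, and let $$\mathrm{dvol}_M = d\theta\wedge\left(y_1\,dy_2\wedge dy_3+y_2\,dy_3\wedge dy_1+y_3\,dy_1\wedge dy_2\right)$$ be its standard volume form. For every cyclic permutation $i,j,k$ of $1,2,3$ let $v_i$ be the vector field $$v_i = y_i\frac{\partial}{\partial\theta} + y_j\frac{\partial}{\partial y_k} - y_k\frac{\partial}{\partial y_j}$$ on $M$. Then $(v_1,v_2,v_3)$ is a normal regular divergence free frame on $(M,\mathrm{dvol}_M)$. This means: (i) (positive divergence free frame) the $v_i$ are smooth vector fields on $M$ with $d\,\iota(v_i)\,\mathrm{dvol}_M=0$ for $i=1,2,3$, and $\mathrm{dvol}_M(v_1,v_2,v_3)>0$ on $M$; (ii) (normal) $\mathrm{dvol}_M(v_1,v_2,v_3)=1$ on $M$; (iii) (regular) every smooth function $f:M\to\mathbb H$ with values in the quaternions that satisfies the Fueter equation $$\mathbf i\,\partial_{v_1}f+\mathbf j\,\partial_{v_2}f+\mathbf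 k\,\partial_{v_3}f=0$$ is constant. -/

import Mathlib

open scoped Manifold ContDiff Quaternion
open Set Metric

noncomputable section

namespace Fueter

/-! ### Differential forms and vector fields on a manifold -/

section General

variable {E : Type*} [NormedAddCommGroup E] [NormedSpace ℝ E]
  {H : Type*} [TopologicalSpace H] (I : ModelWithCorners ℝ E H)
  {M : Type*} [TopologicalSpace M] [ChartedSpace H M]

/-- A (not necessarily smooth) vector field on `M`. -/
abbrev VField : Type _ := Π x : M, TangentSpace I x

/-- A (not necessarily smooth) differential `n`-form on `M`. -/
abbrev DForm (M : Type*) [TopologicalSpace M] [ChartedSpace H M] (n : ℕ) : Type _ :=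
  Π x : M, (TangentSpace I x) [⋀^Fin n]→L[ℝ] ℝ

variable {I}

/-- The coordinate expression of a form in the preferred chart at `x₀`: its pullback under the
inverse of the chart, a form on (the range of the model in) the model vector space `E`. -/
def inChart {n : ℕ} (η : DForm I M n) (x₀ : M) : E → E [⋀^Fin n]→L[ℝ] ℝ := fun y =>
  (η ((extChartAt I x₀).symm y)).compContinuousLinearMap
    (mfderivWithin 𝓘(ℝ, E) I (extChartAt I x₀).symm (range I) y)

/-- A differential form is smooth if all its coordinate expressions are. -/
def IsSmoothForm {n : ℕ} (η : DForm I M n) : Prop :=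
  ∀ x₀ : M, ContDiffOn ℝ ∞ (inChart η x₀) (extChartAt I x₀).target

/-- The exterior derivative of a differential form: at the point `x` it is the exterior derivative
of the coordinate expression in the chart at `x`, pulled back by that chart. -/
def extD {n : ℕ} (η : DForm I M n) : DForm I M (n + 1) := fun x =>
  (extDerivWithin (inChart η x) (range I) (extChartAt I x x)).compContinuousLinearMap
    (mfderiv I 𝓘(ℝ, E) (extChartAt I x) x)

/-- The interior product `ι(v) η`. -/
def interiorProd {n : ℕ} (v : VField I (M := M)) (η : DForm I M (n + 1)) : DForm I M n := fun x =>
  ContinuousAlternatingMap.curryLeft (E := E) (η x) (v x)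

/-- A vector field is smooth if it is a smooth section of the tangent bundle. -/
def IsSmoothVField [IsManifold I ∞ M] (v : VField I (M := M)) : Prop :=
  ContMDiff I I.tangent ∞ (fun x => (⟨x, v x⟩ : TangentBundle I M))

/-- A volume form on a three-manifold (which is then oriented by it):
a smooth, nowhere vanishing `3`-form. -/
structure IsVolumeForm (μ : DForm I M 3) : Prop where
  smooth : IsSmoothForm μ
  ne_zero : ∀ x, μ x ≠ 0

/-- `v = (v₁, v₂, v₃)` is a positive divergence free frame for the volume form `μ`:
the `vᵢ` are smooth vector fields, `d ι(vᵢ) μ = 0`, and `μ(v₁, v₂, v₃) > 0`. -/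
structure IsDivergenceFreeFrame [IsManifold I ∞ M] (μ : DForm I M 3)
    (v : Fin 3 → VField I (M := M)) : Prop where
  smooth : ∀ i, IsSmoothVField (v i)
  divergence_free : ∀ i x, extD (interiorProd (v i) μ) x = 0
  positive : ∀ x, 0 < μ x (fun i => v i x)

/-- A divergence free frame is normal if `μ(v₁, v₂, v₃) = 1`. -/
def IsNormal [IsManifold I ∞ M] (μ : DForm I M 3) (v : Fin 3 → VField I (M := M)) : Prop :=
  IsDivergenceFreeFrame μ v ∧ ∀ x, μ x (fun i => v i x) = 1

/-- The imaginary units `𝐢, 𝐣, 𝐤` of the quaternions. -/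
def imUnit : Fin 3 → ℍ[ℝ] := ![⟨0, 1, 0, 0⟩, ⟨0, 0, 1, 0⟩, ⟨0, 0, 0, 1⟩]

/-- The Fueter operator `f ↦ 𝐢 ∂_{v₁} f + 𝐣 ∂_{v₂} f + 𝐤 ∂_{v₃} f`. -/
def fueter (v : Fin 3 → VField I (M := M)) (f : M → ℍ[ℝ]) : M → ℍ[ℝ] := fun x =>
  ∑ i, imUnit i * mvfderiv I f x (v i x)

/-- A divergence free frame is regular if every smooth solution `f : M → ℍ` of the
Fueter equation is constant. -/
def IsRegular [IsManifold I ∞ M] (μ : DForm I M 3) (v : Fin 3 → VField I (M := M)) : Prop :=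
  IsDivergenceFreeFrame μ v ∧
    ∀ f : M → ℍ[ℝ], ContMDiff I 𝓘(ℝ, ℍ[ℝ]) ∞ f → (∀ x, fueter v f x = 0) → ∃ c, ∀ x, f x = c

end General

/-- The wedge product `ℓ₁ ∧ ... ∧ ℓₙ` of `n` linear functionals (`u ↦ det (ℓᵢ (uⱼ))`). -/
def wedge {V : Type*} [NormedAddCommGroup V] [NormedSpace ℝ V] {n : ℕ} (l : Fin n → V →L[ℝ] ℝ) :
    V [⋀^Fin n]→L[ℝ] ℝ :=
  ContinuousMultilinearMap.alternatization
    ((ContinuousMultilinearMap.mkPiAlgebra ℝ (Fin n) ℝ).compContinuousLinearMap l)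

theorem wedge_apply {V : Type*} [NormedAddCommGroup V] [NormedSpace ℝ V] {n : ℕ}
    (l : Fin n → V →L[ℝ] ℝ) (u : Fin n → V) :
    wedge l u = (Matrix.of fun i j => l i (u j)).det := by
  rw [← Matrix.det_transpose, Matrix.det_apply]
  simp [wedge, ContinuousMultilinearMap.alternatization_apply_apply, Matrix.transpose]

/-! ### The product `S¹ × S²` -/

/-- The unit sphere in `ℝ³`. -/
abbrev S2 : Type := sphere (0 : EuclideanSpace ℝ (Fin 3)) 1

/-- The product of the unit circle in `ℂ` and the unit sphere in `ℝ³`. -/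
abbrev S1S2 : Type := Circle × S2

/-- The model with corners of `S¹ × S²`. -/
abbrev I12 := (𝓡 1).prod (𝓡 2)

/-- The ambient space `ℂ × ℝ³` of `S¹ × S²`. -/
abbrev Ambient : Type := ℂ × EuclideanSpace ℝ (Fin 3)

/-- The inclusion of `S¹ × S²` in `ℂ × ℝ³`. -/
def incl (p : S1S2) : Ambient := ((p.1 : ℂ), (p.2 : EuclideanSpace ℝ (Fin 3)))

/-- The form `dθ = Re z d(Im z) - Im z d(Re z)` on `ℂ × ℝ³`, at a point with `|z| = 1`. -/
def dtheta (q : Ambient) : Ambient →L[ℝ] ℝ :=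
  (q.1.re • Complex.imCLM - q.1.im • Complex.reCLM).comp
    (ContinuousLinearMap.fst ℝ ℂ (EuclideanSpace ℝ (Fin 3)))

/-- The coordinate differentials `dy₁, dy₂, dy₃` on `ℂ × ℝ³`. -/
def dy (i : Fin 3) : Ambient →L[ℝ] ℝ :=
  (EuclideanSpace.proj i : EuclideanSpace ℝ (Fin 3) →L[ℝ] ℝ).comp
    (ContinuousLinearMap.snd ℝ ℂ (EuclideanSpace ℝ (Fin 3)))

/-- `dθ ∧ (y₁ dy₂ ∧ dy₃ + y₂ dy₃ ∧ dy₁ + y₃ dy₁ ∧ dy₂)` on `ℂ × ℝ³`. -/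
def ambientVol (q : Ambient) : Ambient [⋀^Fin 3]→L[ℝ] ℝ :=
  ∑ i : Fin 3, q.2 i • wedge ![dtheta q, dy (i + 1), dy (i + 2)]

/-- The standard volume form `dθ ∧ dvol_{S²}` on `S¹ × S²`. -/
def vol : DForm I12 S1S2 3 := fun p =>
  (ambientVol (incl p)).compContinuousLinearMap (mvfderiv I12 incl p)

/-- The vector `yᵢ ∂_θ + (yⱼ ∂_{y_k} - y_k ∂_{yⱼ})` of `ℂ × ℝ³`, where `i, j, k` is a cyclic
permutation of the three indices and `∂_θ` at `z` is the vector `𝑖 z`. -/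
def ambientFrame (i : Fin 3) (q : Ambient) : Ambient :=
  (q.2 i • (Complex.I * q.1),
    q.2 (i + 1) • EuclideanSpace.single (i + 2) 1 - q.2 (i + 2) • EuclideanSpace.single (i + 1) 1)

attribute [local instance] finrank_real_complex_fact'

theorem hasMFDerivAt_circle (z : Circle) :
    HasMFDerivAt (𝓡 1) 𝓘(ℝ, ℂ) (fun z : Circle => (z : ℂ)) z
      (mvfderiv (𝓡 1) (fun z : Circle => (z : ℂ)) z) :=
  ((contMDiff_coe_sphere (E := ℂ) (n := 1) (m := 1) z).mdifferentiableAt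
    one_ne_zero).hasMFDerivAt

theorem hasMFDerivAt_S2 (y : S2) :
    HasMFDerivAt (𝓡 2) 𝓘(ℝ, EuclideanSpace ℝ (Fin 3))
      (fun y : S2 => (y : EuclideanSpace ℝ (Fin 3))) y
      (mvfderiv (𝓡 2) (fun y : S2 => (y : EuclideanSpace ℝ (Fin 3))) y) :=
  haveI := Fact.mk (@finrank_euclideanSpace_fin ℝ _ 3)
  ((contMDiff_coe_sphere (E := EuclideanSpace ℝ (Fin 3)) (n := 2) (m := 1) y).mdifferentiableAt
    one_ne_zero).hasMFDerivAt

theorem mvfderiv_incl (p : S1S2) (u : TangentSpace I12 p) :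
    mvfderiv I12 incl p u =
      (mvfderiv (𝓡 1) (fun z : Circle => (z : ℂ)) p.1 u.1,
        mvfderiv (𝓡 2) (fun y : S2 => (y : EuclideanSpace ℝ (Fin 3))) p.2 u.2) := by
  have h1 := (hasMFDerivAt_circle p.1).comp p (hasMFDerivAt_fst (I := 𝓡 1) (I' := 𝓡 2) (x := p))
  have h2 := (hasMFDerivAt_S2 p.2).comp p (hasMFDerivAt_snd (I := 𝓡 1) (I' := 𝓡 2) (x := p))
  have h : HasMFDerivAt I12 𝓘(ℝ, Ambient) incl p _ := ⟨h1.1.prodMk h2.1, h1.2.prodMk h2.2⟩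
  exact congrArg (fun L => L u) h.mfderiv

theorem exists_mvfderiv_incl_eq (i : Fin 3) (p : S1S2) :
    ∃ u : TangentSpace I12 p, mvfderiv I12 incl p u = ambientFrame i (incl p) := by
  have := Fact.mk (@finrank_euclideanSpace_fin ℝ _ 3)
  obtain ⟨z, y⟩ := p
  have h1 : Complex.I * (z : ℂ) ∈ (mvfderiv (𝓡 1) (fun z : Circle => (z : ℂ)) z).range := by
    have h := range_mvfderiv_subtypeVal (E := ℂ) (n := 1) z
    refine (SetLike.ext_iff.mp h _).2 ?_
    rw [Submodule.mem_orthogonal_singleton_iff_inner_right, Complex.inner]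
    simp
    ring
  have h2 : (ambientFrame i (incl (z, y))).2 ∈
      (mvfderiv (𝓡 2) (fun y : S2 => (y : EuclideanSpace ℝ (Fin 3))) y).range := by
    have h := range_mvfderiv_subtypeVal (E := EuclideanSpace ℝ (Fin 3)) (n := 2) y
    refine (SetLike.ext_iff.mp h _).2 ?_
    rw [Submodule.mem_orthogonal_singleton_iff_inner_right]
    simp [ambientFrame, incl, inner_sub_right, inner_smul_right,
      EuclideanSpace.inner_single_right]
    ring
  obtain ⟨a, ha⟩ := h1
  obtain ⟨b, hb⟩ := h2
  refine ⟨((y.1 i • a, b) : EuclideanSpace ℝ (Fin 1) × EuclideanSpace ℝ (Fin 2)), ?_⟩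
  refine (mvfderiv_incl (z, y) _).trans (Prod.ext ?_ hb)
  exact (map_smul (mvfderiv (𝓡 1) (fun z : Circle => (z : ℂ)) z) (y.1 i) a).trans
    (congrArg (fun w : ℂ => y.1 i • w) ha)

theorem mvfderiv_incl_injective (p : S1S2) :
    Function.Injective (mvfderiv I12 incl p) := by
  have := Fact.mk (@finrank_euclideanSpace_fin ℝ _ 3)
  intro u w h
  rw [mvfderiv_incl, mvfderiv_incl] at h
  exact Prod.ext
    (injective_mvfderiv_subtypeVal_sphere (E := ℂ) (n := 1) p.1 (congrArg Prod.fst h))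
    (injective_mvfderiv_subtypeVal_sphere (E := EuclideanSpace ℝ (Fin 3)) (n := 2) p.2
      (congrArg Prod.snd h))

/-- The vector field `vᵢ = yᵢ ∂_θ + (yⱼ ∂_{y_k} - y_k ∂_{yⱼ})` on `S¹ × S²`: the tangent vector
`vᵢ(p)` is the unique one that the differential of the inclusion in `ℂ × ℝ³` maps to the
corresponding vector of `ℂ × ℝ³`. -/
def frame (i : Fin 3) : VField I12 (M := S1S2) := fun p => (exists_mvfderiv_incl_eq i p).choose

theorem mvfderiv_incl_frame (i : Fin 3) (p : S1S2) :
    mvfderiv I12 incl p (frame i p) = ambientFrame i (incl p) :=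
  (exists_mvfderiv_incl_eq i p).choose_spec

end Fueter

end

noncomputable section

namespace Fueter

attribute [local instance] finrank_real_complex_fact'

/-! ### Wedge products of smooth functionals -/

section Wedge

variable {V : Type*} [NormedAddCommGroup V] [NormedSpace ℝ V] {n : ℕ}

/-- Alternatization of continuous multilinear forms, as a continuous linear map. -/
def alternatizationL (V : Type*) [NormedAddCommGroup V] [NormedSpace ℝ V] (n : ℕ) :
    ContinuousMultilinearMap ℝ (fun _ : Fin n => V) ℝ →L[ℝ] V [⋀^Fin n]→L[ℝ] ℝ :=
  LinearMap.mkContinuous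
    { toFun := fun f => f.alternatization
      map_add' := map_add _
      map_smul' := fun c f => by
        ext v
        simp [ContinuousMultilinearMap.alternatization_apply_apply, mul_smul_comm, Finset.mul_sum] }
    (Fintype.card (Equiv.Perm (Fin n))) fun f => by
      refine ContinuousAlternatingMap.opNorm_le_bound _ (by positivity) fun v => ?_
      change ‖f.alternatization v‖ ≤ _
      rw [ContinuousMultilinearMap.alternatization_apply_apply]
      refine (norm_sum_le _ _).trans ?_
      rw [mul_assoc, Fintype.card, ← nsmul_eq_mul]
      refine Finset.sum_le_card_nsmul _ _ _ fun σ _ => ?_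
      have h : ‖Equiv.Perm.sign σ • f (v ∘ σ)‖ = ‖f (v ∘ σ)‖ := by
        rcases Int.units_eq_one_or (Equiv.Perm.sign σ) with h | h <;> simp [h]
      rw [h]
      refine (f.le_opNorm _).trans_eq ?_
      congr 1
      exact Equiv.prod_comp σ fun i => ‖v i‖

theorem contDiff_wedge {m : WithTop ℕ∞} :
    ContDiff ℝ m (wedge : (Fin n → V →L[ℝ] ℝ) → V [⋀^Fin n]→L[ℝ] ℝ) := by
  have h := ContinuousMultilinearMap.contDiff (𝕜 := ℝ) (E := fun _ : Fin n => V →L[ℝ] ℝ) (n := m)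
    (F := ContinuousMultilinearMap ℝ (fun _ : Fin n => ℝ) ℝ →L[ℝ]
      ContinuousMultilinearMap ℝ (fun _ : Fin n => V) ℝ)
    (ContinuousMultilinearMap.compContinuousLinearMapContinuousMultilinear ℝ
      (fun _ : Fin n => V) (fun _ => ℝ) ℝ)
  exact (alternatizationL V n).contDiff.comp
    (h.clm_apply (contDiff_const (c := ContinuousMultilinearMap.mkPiAlgebra ℝ (Fin n) ℝ)))

end Wedge

theorem ambientVol_apply (q : Ambient) (u : Fin 3 → Ambient) :
    ambientVol q u = ∑ i : Fin 3, q.2 i *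
      (Matrix.of fun a b => (![dtheta q, dy (i + 1), dy (i + 2)] a : Ambient →L[ℝ] ℝ) (u b)).det := by
  simp [ambientVol, ContinuousAlternatingMap.sum_apply, wedge_apply]

theorem sum_sq_coe_S2 (y : S2) : (y : EuclideanSpace ℝ (Fin 3)) 0 ^ 2 +
    (y : EuclideanSpace ℝ (Fin 3)) 1 ^ 2 + (y : EuclideanSpace ℝ (Fin 3)) 2 ^ 2 = 1 := by
  have h : ‖(y : EuclideanSpace ℝ (Fin 3))‖ ^ 2 = 1 := by simp
  rw [EuclideanSpace.norm_sq_eq, Fin.sum_univ_three] at h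
  simpa using h

theorem re_sq_add_im_sq_coe_circle (z : Circle) : (z : ℂ).re ^ 2 + (z : ℂ).im ^ 2 = 1 := by
  have h := Circle.normSq_coe z
  rw [Complex.normSq_apply] at h
  linarith

theorem dtheta_apply (q u : Ambient) : dtheta q u = q.1.re * u.1.im - q.1.im * u.1.re := by
  simp [dtheta]

theorem dy_apply (i : Fin 3) (u : Ambient) : dy i u = u.2 i := by
  simp [dy]

theorem ambientVol_ambientFrame (p : S1S2) :
    ambientVol (incl p) (fun i => ambientFrame i (incl p)) = 1 := by
  have hy := sum_sq_coe_S2 p.2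
  have hz := re_sq_add_im_sq_coe_circle p.1
  rw [ambientVol_apply]
  simp [Fin.sum_univ_three, Matrix.det_fin_three, dtheta_apply, dy_apply, ambientFrame, incl]
  generalize (p.2 : EuclideanSpace ℝ (Fin 3)) 0 = a at *
  generalize (p.2 : EuclideanSpace ℝ (Fin 3)) 1 = b at *
  generalize (p.2 : EuclideanSpace ℝ (Fin 3)) 2 = c at *
  linear_combination (a ^ 2 + b ^ 2 + c ^ 2) ^ 2 * hz + (a ^ 2 + b ^ 2 + c ^ 2 + 1) * hy

/-! ### Forms on `S¹ × S²` pulled back from the ambient space -/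

instance fact_finrank_euclideanSpace_three :
    Fact (Module.finrank ℝ (EuclideanSpace ℝ (Fin 3)) = 2 + 1) :=
  ⟨finrank_euclideanSpace_fin⟩

theorem contMDiff_coe_circle {m : WithTop ℕ∞} :
    ContMDiff (𝓡 1) 𝓘(ℝ, ℂ) m (fun z : Circle => (z : ℂ)) :=
  contMDiff_coe_sphere (E := ℂ) (n := 1)

theorem contMDiff_coe_S2 {m : WithTop ℕ∞} :
    ContMDiff (𝓡 2) 𝓘(ℝ, EuclideanSpace ℝ (Fin 3)) m
      (fun y : S2 => (y : EuclideanSpace ℝ (Fin 3))) :=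
  contMDiff_coe_sphere (E := EuclideanSpace ℝ (Fin 3)) (n := 2)

theorem contMDiff_incl {m : WithTop ℕ∞} : ContMDiff I12 𝓘(ℝ, Ambient) m incl :=
  (contMDiff_coe_circle.comp contMDiff_fst).prodMk_space (contMDiff_coe_S2.comp contMDiff_snd)

/-- The model vector space of `S¹ × S²`. -/
abbrev Model : Type := EuclideanSpace ℝ (Fin 1) × EuclideanSpace ℝ (Fin 2)

/-- The local parametrization of `S¹ × S² ⊆ ℂ × ℝ³` given by the chart at `x₀`. -/
def localParam (x₀ : S1S2) : Model → Ambient := fun y => incl ((extChartAt I12 x₀).symm y)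

theorem contDiffOn_localParam (x₀ : S1S2) {m : WithTop ℕ∞} :
    ContDiffOn ℝ m (localParam x₀) (extChartAt I12 x₀).target := by
  rw [← contMDiffOn_iff_contDiffOn]
  exact contMDiff_incl.comp_contMDiffOn (contMDiffOn_extChartAt_symm x₀)

theorem range_I12 : range I12 = univ := ModelWithCorners.range_eq_univ I12

theorem isOpen_target (x₀ : S1S2) : IsOpen (extChartAt I12 x₀).target :=
  isOpen_extChartAt_target x₀

theorem mvfderiv_incl_comp_mfderivWithin (x₀ : S1S2) {y : Model}
    (hy : y ∈ (extChartAt I12 x₀).target) :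
    (mvfderiv I12 incl ((extChartAt I12 x₀).symm y)).comp
      (mfderivWithin 𝓘(ℝ, Model) I12 (extChartAt I12 x₀).symm (range I12) y) =
      fderiv ℝ (localParam x₀) y := by
  have h1 : MDifferentiableAt 𝓘(ℝ, Model) I12 (extChartAt I12 x₀).symm y :=
    ((contMDiffOn_extChartAt_symm (n := 1) x₀).contMDiffAt
      ((isOpen_target x₀).mem_nhds hy)).mdifferentiableAt one_ne_zero
  have h2 : MDifferentiableAt I12 𝓘(ℝ, Ambient) incl ((extChartAt I12 x₀).symm y) :=
    (contMDiff_incl (m := 1)).mdifferentiableAt one_ne_zero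
  rw [range_I12, mfderivWithin_univ, ← mfderiv_eq_fderiv]
  exact (mfderiv_comp y h2 h1).symm

/-- The pullback to `S¹ × S²` of a form on `ℂ × ℝ³`. -/
def pullbackForm {n : ℕ} (η : Ambient → Ambient [⋀^Fin n]→L[ℝ] ℝ) : DForm I12 S1S2 n := fun p =>
  (η (incl p)).compContinuousLinearMap (mvfderiv I12 incl p)

theorem inChart_pullbackForm {n : ℕ} (η : Ambient → Ambient [⋀^Fin n]→L[ℝ] ℝ) (x₀ : S1S2)
    {y : Model} (hy : y ∈ (extChartAt I12 x₀).target) :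
    inChart (pullbackForm η) x₀ y =
      (η (localParam x₀ y)).compContinuousLinearMap (fderiv ℝ (localParam x₀) y) := by
  rw [← mvfderiv_incl_comp_mfderivWithin x₀ hy]
  rfl

theorem contDiff_dtheta {m : WithTop ℕ∞} : ContDiff ℝ m dtheta := by
  have hre : ContDiff ℝ m fun q : Ambient => q.1.re := Complex.reCLM.contDiff.comp contDiff_fst
  have him : ContDiff ℝ m fun q : Ambient => q.1.im := Complex.imCLM.contDiff.comp contDiff_fst
  exact ((hre.smul contDiff_const).sub (him.smul contDiff_const)).clm_comp contDiff_const

theorem isSmoothForm_vol : IsSmoothForm vol := by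
  intro x₀
  have hg := contDiffOn_localParam x₀ (m := ∞)
  have hg' : ContDiffOn ℝ ∞ (fderiv ℝ (localParam x₀)) (extChartAt I12 x₀).target :=
    hg.fderiv_of_isOpen (isOpen_target x₀) (by simp)
  refine ContDiffOn.congr (f := fun y => ∑ i : Fin 3, (localParam x₀ y).2 i •
    wedge fun a => (![dtheta (localParam x₀ y), dy (i + 1), dy (i + 2)] a).comp
      (fderiv ℝ (localParam x₀) y)) ?_ fun y hy => ?_
  · refine ContDiffOn.sum fun i _ => ContDiffOn.fun_smul ?_ (contDiff_wedge.comp_contDiffOn ?_)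
    · exact (dy i).contDiff.comp_contDiffOn hg
    · refine contDiffOn_pi.2 fun a => ContDiffOn.clm_comp ?_ hg'
      fin_cases a
      · exact contDiff_dtheta.comp_contDiffOn hg
      · exact contDiffOn_const
      · exact contDiffOn_const
  · refine (inChart_pullbackForm ambientVol x₀ hy).trans ?_
    ext u
    simp [ambientVol, ContinuousAlternatingMap.sum_apply, wedge_apply]

theorem vol_frame (p : S1S2) : vol p (fun i => frame i p) = 1 := by
  exact (congrArg (ambientVol (incl p)) (funext fun i => mvfderiv_incl_frame i p)).trans
    (ambientVol_ambientFrame p)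

theorem isVolumeForm_vol : IsVolumeForm vol where
  smooth := isSmoothForm_vol
  ne_zero p h := by
    have h1 := vol_frame p
    rw [h] at h1
    exact zero_ne_one h1

theorem extD_pullbackForm {n : ℕ} {η : Ambient → Ambient [⋀^Fin n]→L[ℝ] ℝ} {x : S1S2}
    (hη : DifferentiableAt ℝ η (incl x))
    (h0 : ∀ a : Fin (n + 1) → Ambient, (∀ j, a j ∈ (mvfderiv I12 incl x).range) →
      extDeriv η (incl x) a = 0) :
    extD (pullbackForm η) x = 0 := by
  have hx : extChartAt I12 x x ∈ (extChartAt I12 x).target := mem_extChartAt_target x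
  have hgx : localParam x (extChartAt I12 x x) = incl x :=
    congrArg incl (extChartAt_to_inv x)
  have h : inChart (pullbackForm η) x =ᶠ[nhds (extChartAt I12 x x)] fun y =>
      (η (localParam x y)).compContinuousLinearMap (fderiv ℝ (localParam x) y) := by
    filter_upwards [(isOpen_target x).mem_nhds hx] with y hy
    exact inChart_pullbackForm η x hy
  have hg : ContDiffAt ℝ 2 (localParam x) (extChartAt I12 x x) :=
    (contDiffOn_localParam x).contDiffAt ((isOpen_target x).mem_nhds hx)
  have h2 : extDeriv (inChart (pullbackForm η) x) (extChartAt I12 x x) = 0 := by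
    rw [h.extDeriv_eq, extDeriv_pullback (by rwa [hgx]) hg (by simp)]
    ext u
    refine (congrArg (fun q => extDeriv η q _) hgx).trans (h0 _ fun j => ?_)
    have hr : ∀ p w, p = x → mvfderiv I12 incl p w ∈ (mvfderiv I12 incl x).range := by
      rintro p w rfl
      exact ⟨w, rfl⟩
    change fderiv ℝ (localParam x) (extChartAt I12 x x) (u j) ∈ _
    rw [← mvfderiv_incl_comp_mfderivWithin x hx]
    exact hr _ _ (extChartAt_to_inv x)
  unfold extD
  rw [range_I12, extDerivWithin_univ]
  erw [h2]
  rfl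

/-! ### The frame is divergence free -/

theorem tangent_of_mem_range {p : S1S2} {a : Ambient} (ha : a ∈ (mvfderiv I12 incl p).range) :
    ((p.1 : ℂ).re * a.1.re + (p.1 : ℂ).im * a.1.im = 0) ∧
      (incl p).2 0 * a.2 0 + (incl p).2 1 * a.2 1 + (incl p).2 2 * a.2 2 = 0 := by
  obtain ⟨w, rfl⟩ := ha
  have h1 := range_mvfderiv_subtypeVal (E := ℂ) (n := 1) p.1
  have h2 := range_mvfderiv_subtypeVal (E := EuclideanSpace ℝ (Fin 3)) (n := 2) p.2
  have h1' := (SetLike.ext_iff.mp h1 (mvfderiv (𝓡 1) (fun z : Circle => (z : ℂ)) p.1 w.1)).1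
    ⟨w.1, rfl⟩
  have h2' := (SetLike.ext_iff.mp h2 (mvfderiv (𝓡 2)
    (fun y : S2 => (y : EuclideanSpace ℝ (Fin 3))) p.2 w.2)).1 ⟨w.2, rfl⟩
  rw [Submodule.mem_orthogonal_singleton_iff_inner_right] at h1' h2'
  have e : (mvfderiv I12 incl p) w = _ := mvfderiv_incl p w
  refine ⟨?_, ?_⟩
  · rw [Complex.inner] at h1'
    simp at h1'
    change _ * (mvfderiv I12 incl p w).1.re + _ * (mvfderiv I12 incl p w).1.im = 0
    rw [e]
    linarith
  · rw [PiLp.inner_apply, Fin.sum_univ_three] at h2'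
    simp at h2'
    change _ * (mvfderiv I12 incl p w).2 0 + _ * (mvfderiv I12 incl p w).2 1 +
       _ * (mvfderiv I12 incl p w).2 2  = 0
    rw [e]
    simp only [incl]
    linarith

/-- The form `yᵢ σ - dθ ∧ dyᵢ`, where `σ` is the area form of `S²`: it agrees on `S¹ × S²` with
the contraction of the volume form with `vᵢ`. -/
def contractedVol (i : Fin 3) (q : Ambient) : Ambient [⋀^Fin 2]→L[ℝ] ℝ :=
  q.2 i • ∑ j : Fin 3, q.2 j • wedge ![dy (j + 1), dy (j + 2)] - wedge ![dtheta q, dy i]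

theorem contractedVol_apply (i : Fin 3) (q : Ambient) (u : Fin 2 → Ambient) :
    contractedVol i q u = q.2 i * (∑ j : Fin 3, q.2 j *
      ((u 0).2 (j + 1) * (u 1).2 (j + 2) - (u 1).2 (j + 1) * (u 0).2 (j + 2))) -
      (dtheta q (u 0) * (u 1).2 i - dtheta q (u 1) * (u 0).2 i) := by
  simp [contractedVol, wedge_apply, Matrix.det_fin_two, dy_apply]

theorem interiorProd_frame_vol (i : Fin 3) :
    interiorProd (frame i) vol = pullbackForm (contractedVol i) := by
  funext p
  ext u
  have ha := tangent_of_mem_range (p := p) (a := mvfderiv I12 incl p (u 0)) ⟨_, rfl⟩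
  have hb := tangent_of_mem_range (p := p) (a := mvfderiv I12 incl p (u 1)) ⟨_, rfl⟩
  have h : interiorProd (frame i) vol p u = ambientVol (incl p)
      ![ambientFrame i (incl p), mvfderiv I12 incl p (u 0), mvfderiv I12 incl p (u 1)] := by
    refine congrArg (ambientVol (incl p)) (funext fun j => ?_)
    fin_cases j
    · exact mvfderiv_incl_frame i p
    · rfl
    · rfl
  have h' : pullbackForm (contractedVol i) p u = contractedVol i (incl p)
      ![mvfderiv I12 incl p (u 0), mvfderiv I12 incl p (u 1)] := by
    refine congrArg (contractedVol i (incl p)) (funext fun j => ?_)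
    fin_cases j <;> rfl
  rw [h, h']
  generalize mvfderiv I12 incl p (u 0) = a at *
  generalize mvfderiv I12 incl p (u 1) = b at *
  have hy := sum_sq_coe_S2 p.2
  have hz := re_sq_add_im_sq_coe_circle p.1
  clear h h'
  rw [ambientVol_apply, contractedVol_apply]
  obtain ⟨z, y⟩ := p
  obtain ⟨-, ha⟩ := ha
  obtain ⟨-, hb⟩ := hb
  have key : ∀ i : Fin 3, (y : EuclideanSpace ℝ (Fin 3)) i * ((incl (z, y)).2 0 *
      (a.2 1 * b.2 2 - b.2 1 * a.2 2) + (incl (z, y)).2 1 *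
      (a.2 2 * b.2 0 - b.2 2 * a.2 0) + (incl (z, y)).2 2 * (a.2 0 * b.2 1 - b.2 0 * a.2 1)) *
        ((z : ℂ).re ^ 2 + (z : ℂ).im ^ 2 - 1) +
      ((z : ℂ).re * a.1.im - (z : ℂ).im * a.1.re) * ((y : EuclideanSpace ℝ (Fin 3)) i *
        ((incl (z, y)).2 0 * b.2 0 + (incl (z, y)).2 1 * b.2 1 + (incl (z, y)).2 2 * b.2 2) -
        b.2 i * ((y : EuclideanSpace ℝ (Fin 3)) 0 ^ 2 +
        (y : EuclideanSpace ℝ (Fin 3)) 1 ^ 2 + (y : EuclideanSpace ℝ (Fin 3)) 2 ^ 2 - 1)) -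
      ((z : ℂ).re * b.1.im - (z : ℂ).im * b.1.re) * ((y : EuclideanSpace ℝ (Fin 3)) i *
        ((incl (z, y)).2 0 * a.2 0 + (incl (z, y)).2 1 * a.2 1 + (incl (z, y)).2 2 * a.2 2) -
        a.2 i * ((y : EuclideanSpace ℝ (Fin 3)) 0 ^ 2 +
        (y : EuclideanSpace ℝ (Fin 3)) 1 ^ 2 + (y : EuclideanSpace ℝ (Fin 3)) 2 ^ 2 - 1)) = 0 := by
    intro i
    rw [ha, hb, hy, hz]
    ring
  replace key := key i
  clear ha hb hy hz
  simp only [incl] at key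
  fin_cases i <;>
  · simp [Fin.sum_univ_three, Matrix.det_fin_three, dtheta_apply, dy_apply, ambientFrame, incl]
      at key ⊢
    linear_combination key

theorem contDiff_contractedVol (i : Fin 3) : ContDiff ℝ 1 (contractedVol i) := by
  have h (j : Fin 3) : ContDiff ℝ 1 fun q : Ambient => q.2 j := (dy j).contDiff
  have hw : ContDiff ℝ 1 fun q : Ambient => wedge ![dtheta q, dy i] := by
    refine contDiff_wedge.comp (contDiff_pi.2 fun a => ?_)
    fin_cases a
    · exact contDiff_dtheta
    · exact contDiff_const
  exact ((h i).smul (ContDiff.sum fun j _ => (h j).smul contDiff_const)).sub hw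

theorem fderiv_contractedVol_apply (i : Fin 3) (q w : Ambient) (u : Fin 2 → Ambient) :
    fderiv ℝ (fun x => contractedVol i x u) q w =
      w.2 i * (∑ j : Fin 3, q.2 j *
        ((u 0).2 (j + 1) * (u 1).2 (j + 2) - (u 1).2 (j + 1) * (u 0).2 (j + 2))) +
      q.2 i * (∑ j : Fin 3, w.2 j *
        ((u 0).2 (j + 1) * (u 1).2 (j + 2) - (u 1).2 (j + 1) * (u 0).2 (j + 2))) -
      (dtheta w (u 0) * (u 1).2 i - dtheta w (u 1) * (u 0).2 i) := by
  have h (j : Fin 3) : HasFDerivAt (fun x : Ambient => x.2 j) (dy j) q := (dy j).hasFDerivAt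
  have hre : HasFDerivAt (fun x : Ambient => x.1.re)
      (Complex.reCLM.comp (ContinuousLinearMap.fst ℝ ℂ (EuclideanSpace ℝ (Fin 3)))) q :=
    Complex.reCLM.hasFDerivAt.comp q hasFDerivAt_fst
  have him : HasFDerivAt (fun x : Ambient => x.1.im)
      (Complex.imCLM.comp (ContinuousLinearMap.fst ℝ ℂ (EuclideanSpace ℝ (Fin 3)))) q :=
    Complex.imCLM.hasFDerivAt.comp q hasFDerivAt_fst
  have ht (v : Ambient) := (hre.mul_const v.1.im).sub (him.mul_const v.1.re)
  have hs := HasFDerivAt.fun_sum (u := Finset.univ) fun (j : Fin 3) _ => (h j).mul_const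
    ((u 0).2 (j + 1) * (u 1).2 (j + 2) - (u 1).2 (j + 1) * (u 0).2 (j + 2))
  have hall := ((h i).mul hs).sub
    (((ht (u 0)).mul_const ((u 1).2 i)).sub ((ht (u 1)).mul_const ((u 0).2 i)))
  have he : (fun x => contractedVol i x u) = _ := funext fun x => contractedVol_apply i x u
  simp only [dtheta_apply] at he ⊢
  rw [he]
  refine (congrArg (fun l : Ambient →L[ℝ] ℝ => l w) hall.fderiv).trans ?_
  simp [Fin.sum_univ_three, dy_apply]
  ring

theorem det_eq_zero_of_orthogonal {y a b c : EuclideanSpace ℝ (Fin 3)}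
    (hy : y 0 ^ 2 + y 1 ^ 2 + y 2 ^ 2 = 1) (ha : y 0 * a 0 + y 1 * a 1 + y 2 * a 2 = 0)
    (hb : y 0 * b 0 + y 1 * b 1 + y 2 * b 2 = 0) (hc : y 0 * c 0 + y 1 * c 1 + y 2 * c 2 = 0) :
    a 0 * (b 1 * c 2 - b 2 * c 1) + a 1 * (b 2 * c 0 - b 0 * c 2) +
      a 2 * (b 0 * c 1 - b 1 * c 0) = 0 := by
  linear_combination -(a 0 * (b 1 * c 2 - b 2 * c 1) + a 1 * (b 2 * c 0 - b 0 * c 2) +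
      a 2 * (b 0 * c 1 - b 1 * c 0)) * hy +
    (y 0 * (b 1 * c 2 - b 2 * c 1) + y 1 * (b 2 * c 0 - b 0 * c 2) +
      y 2 * (b 0 * c 1 - b 1 * c 0)) * ha +
    (y 0 * (c 1 * a 2 - c 2 * a 1) + y 1 * (c 2 * a 0 - c 0 * a 2) +
      y 2 * (c 0 * a 1 - c 1 * a 0)) * hb +
    (y 0 * (a 1 * b 2 - a 2 * b 1) + y 1 * (a 2 * b 0 - a 0 * b 2) +
      y 2 * (a 0 * b 1 - a 1 * b 0)) * hc

theorem re_mul_im_sub_eq_zero_of_orthogonal {z a b : ℂ} (hz : z.re ^ 2 + z.im ^ 2 = 1)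
    (ha : z.re * a.re + z.im * a.im = 0) (hb : z.re * b.re + z.im * b.im = 0) :
    a.re * b.im - a.im * b.re = 0 := by
  linear_combination -(a.re * b.im - a.im * b.re) * hz + (z.re * b.im - z.im * b.re) * ha -
    (z.re * a.im - z.im * a.re) * hb

theorem extDeriv_contractedVol (i : Fin 3) (p : S1S2) (a : Fin 3 → Ambient)
    (ha : ∀ j, a j ∈ (mvfderiv I12 incl p).range) :
    extDeriv (contractedVol i) (incl p) a = 0 := by
  rw [extDeriv_apply ((contDiff_contractedVol i).contDiffAt.differentiableAt one_ne_zero)]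
  have ht j := tangent_of_mem_range (ha j)
  have hd := det_eq_zero_of_orthogonal (sum_sq_coe_S2 p.2) (ht 0).2 (ht 1).2 (ht 2).2
  have hz := re_sq_add_im_sq_coe_circle p.1
  have h01 := re_mul_im_sub_eq_zero_of_orthogonal hz (ht 0).1 (ht 1).1
  have h02 := re_mul_im_sub_eq_zero_of_orthogonal hz (ht 0).1 (ht 2).1
  have h12 := re_mul_im_sub_eq_zero_of_orthogonal hz (ht 1).1 (ht 2).1
  clear ht ha
  simp only [Fin.sum_univ_three, fderiv_contractedVol_apply, dtheta_apply]
  fin_cases i <;> simp [Fin.sum_univ_three, Fin.removeNth, Fin.succAbove, incl]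
  · linear_combination 4 * (p.2 : EuclideanSpace ℝ (Fin 3)) 0 * hd - 2 * (a 2).2 0 * h01 +
      2 * (a 1).2 0 * h02 - 2 * (a 0).2 0 * h12
  · linear_combination 4 * (p.2 : EuclideanSpace ℝ (Fin 3)) 1 * hd - 2 * (a 2).2 1 * h01 +
      2 * (a 1).2 1 * h02 - 2 * (a 0).2 1 * h12
  · linear_combination 4 * (p.2 : EuclideanSpace ℝ (Fin 3)) 2 * hd - 2 * (a 2).2 2 * h01 +
      2 * (a 1).2 2 * h02 - 2 * (a 0).2 2 * h12

theorem extD_interiorProd_frame_vol (i : Fin 3) (x : S1S2) :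
    extD (interiorProd (frame i) vol) x = 0 := by
  rw [interiorProd_frame_vol]
  exact extD_pullbackForm ((contDiff_contractedVol i).contDiffAt.differentiableAt one_ne_zero)
    (extDeriv_contractedVol i x)

/-! ### Rotations of the sphere and smoothness of the frame -/

/-- The rotation by the angle `t` about the `i`-th coordinate axis of `ℝ³`. -/
def rotation (i : Fin 3) (t : ℝ) :
    EuclideanSpace ℝ (Fin 3) →ₗᵢ[ℝ] EuclideanSpace ℝ (Fin 3) where
  toFun y := y i • EuclideanSpace.single i 1 +
    (Real.cos t * y (i + 1) - Real.sin t * y (i + 2)) • EuclideanSpace.single (i + 1) 1 +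
    (Real.sin t * y (i + 1) + Real.cos t * y (i + 2)) • EuclideanSpace.single (i + 2) 1
  map_add' x y := by
    simp only [PiLp.add_apply]
    module
  map_smul' c x := by
    simp only [PiLp.smul_apply, smul_eq_mul, RingHom.id_apply]
    module
  norm_map' y := by
    rw [← sq_eq_sq₀ (norm_nonneg _) (norm_nonneg _), EuclideanSpace.norm_sq_eq,
      EuclideanSpace.norm_sq_eq, Fin.sum_univ_three, Fin.sum_univ_three]
    have h := Real.sin_sq_add_cos_sq t
    fin_cases i <;> simp
    · linear_combination (y 1 ^ 2 + y 2 ^ 2) * h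
    · linear_combination (y 2 ^ 2 + y 0 ^ 2) * h
    · linear_combination (y 0 ^ 2 + y 1 ^ 2) * h

theorem rotation_apply (i : Fin 3) (t : ℝ) (y : EuclideanSpace ℝ (Fin 3)) :
    rotation i t y = y i • EuclideanSpace.single i 1 +
    (Real.cos t * y (i + 1) - Real.sin t * y (i + 2)) • EuclideanSpace.single (i + 1) 1 +
    (Real.sin t * y (i + 1) + Real.cos t * y (i + 2)) • EuclideanSpace.single (i + 2) 1 := rfl

theorem rotation_coord (i : Fin 3) (t : ℝ) (y : EuclideanSpace ℝ (Fin 3)) :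
    rotation i t y i = y i ∧
      rotation i t y (i + 1) = Real.cos t * y (i + 1) - Real.sin t * y (i + 2) ∧
      rotation i t y (i + 2) = Real.sin t * y (i + 1) + Real.cos t * y (i + 2) := by
  fin_cases i <;> simp [rotation_apply]

theorem rotation_zero (i : Fin 3) (y : EuclideanSpace ℝ (Fin 3)) : rotation i 0 y = y := by
  ext j
  fin_cases i <;> fin_cases j <;> simp [rotation_apply]

theorem rotation_two_pi (i : Fin 3) (y : EuclideanSpace ℝ (Fin 3)) :
    rotation i (2 * Real.pi) y = y := by
  ext j
  fin_cases i <;> fin_cases j <;> simp [rotation_apply]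

/-- The infinitesimal rotation `y_{i+1} ∂_{i+2} - y_{i+2} ∂_{i+1}`. -/
def rotationField (i : Fin 3) :
    EuclideanSpace ℝ (Fin 3) →L[ℝ] EuclideanSpace ℝ (Fin 3) :=
  (EuclideanSpace.proj (i + 1) : EuclideanSpace ℝ (Fin 3) →L[ℝ] ℝ).smulRight
      (EuclideanSpace.single (i + 2) 1) -
    (EuclideanSpace.proj (i + 2) : EuclideanSpace ℝ (Fin 3) →L[ℝ] ℝ).smulRight
      (EuclideanSpace.single (i + 1) 1)

theorem rotationField_apply (i : Fin 3) (y : EuclideanSpace ℝ (Fin 3)) :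
    rotationField i y =
      y (i + 1) • EuclideanSpace.single (i + 2) 1 - y (i + 2) • EuclideanSpace.single (i + 1) 1 := by
  simp [rotationField]

theorem hasDerivAt_rotation (i : Fin 3) (y : EuclideanSpace ℝ (Fin 3)) (t : ℝ) :
    HasDerivAt (fun t => rotation i t y) (rotationField i (rotation i t y)) t := by
  obtain ⟨h0, h1, h2⟩ := rotation_coord i t y
  rw [rotationField_apply, h1, h2]
  simp only [rotation_apply]
  have hc := Real.hasDerivAt_cos t
  have hs := Real.hasDerivAt_sin t
  have h := ((((hc.mul_const (y (i + 1))).sub (hs.mul_const (y (i + 2)))).smul_const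
    (EuclideanSpace.single (i + 1) (1 : ℝ))).const_add (y i • EuclideanSpace.single i (1 : ℝ))).add
    (((hs.mul_const (y (i + 1))).add (hc.mul_const (y (i + 2)))).smul_const
    (EuclideanSpace.single (i + 2) (1 : ℝ)))
  refine h.congr_deriv ?_
  module

theorem contDiff_rotation (i : Fin 3) {m : WithTop ℕ∞} :
    ContDiff ℝ m fun q : ℝ × EuclideanSpace ℝ (Fin 3) => rotation i q.1 q.2 := by
  have h (j : Fin 3) : ContDiff ℝ m fun q : ℝ × EuclideanSpace ℝ (Fin 3) => q.2 j :=
    (EuclideanSpace.proj j : EuclideanSpace ℝ (Fin 3) →L[ℝ] ℝ).contDiff.comp contDiff_snd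
  have hc : ContDiff ℝ m fun q : ℝ × EuclideanSpace ℝ (Fin 3) => Real.cos q.1 :=
    Real.contDiff_cos.comp contDiff_fst
  have hs : ContDiff ℝ m fun q : ℝ × EuclideanSpace ℝ (Fin 3) => Real.sin q.1 :=
    Real.contDiff_sin.comp contDiff_fst
  exact (((h i).smul contDiff_const).add
    (((hc.mul (h (i + 1))).sub (hs.mul (h (i + 2)))).smul contDiff_const)).add
    (((hs.mul (h (i + 1))).add (hc.mul (h (i + 2)))).smul contDiff_const)

theorem rotation_mem_sphere (i : Fin 3) (t : ℝ) (y : S2) :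
    rotation i t (y : EuclideanSpace ℝ (Fin 3)) ∈ sphere (0 : EuclideanSpace ℝ (Fin 3)) 1 := by
  simp

/-- The rotation of the sphere by the angle `t` about the `i`-th coordinate axis. -/
def rotateS2 (i : Fin 3) (t : ℝ) (y : S2) : S2 := ⟨rotation i t y, rotation_mem_sphere i t y⟩

theorem contMDiff_rotation_coe (i : Fin 3) {m : WithTop ℕ∞} :
    ContMDiff (𝓘(ℝ, ℝ).prod (𝓡 2)) 𝓘(ℝ, EuclideanSpace ℝ (Fin 3)) m
      fun q : ℝ × S2 => rotation i q.1 (q.2 : EuclideanSpace ℝ (Fin 3)) := by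
  have hp : ContMDiff (𝓘(ℝ, ℝ).prod (𝓡 2)) 𝓘(ℝ, ℝ × EuclideanSpace ℝ (Fin 3)) m
      fun q : ℝ × S2 => (q.1, (q.2 : EuclideanSpace ℝ (Fin 3))) :=
    contMDiff_fst.prodMk_space (contMDiff_coe_S2.comp contMDiff_snd)
  have hc : ContMDiff 𝓘(ℝ, ℝ × EuclideanSpace ℝ (Fin 3)) 𝓘(ℝ, EuclideanSpace ℝ (Fin 3)) m
      fun q : ℝ × EuclideanSpace ℝ (Fin 3) => rotation i q.1 q.2 := (contDiff_rotation i).contMDiff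
  have := hc.comp hp
  exact this

theorem contMDiff_rotateS2 (i : Fin 3) {m : WithTop ℕ∞} :
    ContMDiff (𝓘(ℝ, ℝ).prod (𝓡 2)) (𝓡 2) m fun q : ℝ × S2 => rotateS2 i q.1 q.2 :=
  (contMDiff_rotation_coe i).codRestrict_sphere (n := 2) fun q => rotation_mem_sphere i q.1 q.2

/-- The flow of the `i`-th frame field. -/
def frameFlow (i : Fin 3) (q : ℝ × S1S2) : S1S2 :=
  (Circle.exp (q.1 * (q.2.2 : EuclideanSpace ℝ (Fin 3)) i) * q.2.1, rotateS2 i q.1 q.2.2)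

theorem contMDiff_snd_snd {m : WithTop ℕ∞} :
    ContMDiff (𝓘(ℝ, ℝ).prod I12) (𝓡 2) m fun q : ℝ × S1S2 => q.2.2 :=
  contMDiff_snd.comp contMDiff_snd

theorem contMDiff_coord (i : Fin 3) {m : WithTop ℕ∞} :
    ContMDiff (𝓡 2) 𝓘(ℝ, ℝ) m fun y : S2 => (y : EuclideanSpace ℝ (Fin 3)) i := by
  have hp : ContMDiff 𝓘(ℝ, EuclideanSpace ℝ (Fin 3)) 𝓘(ℝ, ℝ) m
      fun y : EuclideanSpace ℝ (Fin 3) => y i :=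
    (EuclideanSpace.proj i : EuclideanSpace ℝ (Fin 3) →L[ℝ] ℝ).contMDiff
  have := hp.comp contMDiff_coe_S2
  exact this

theorem contMDiff_frameFlow_fst (i : Fin 3) {m : WithTop ℕ∞} :
    ContMDiff (𝓘(ℝ, ℝ).prod I12) (𝓡 1) m fun q : ℝ × S1S2 => (frameFlow i q).1 := by
  have h5 : ContMDiff (𝓘(ℝ, ℝ).prod I12) 𝓘(ℝ, ℝ) m fun q : ℝ × S1S2 =>
      (q.2.2 : EuclideanSpace ℝ (Fin 3)) i := (contMDiff_coord i).comp contMDiff_snd_snd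
  have h3 : ContMDiff (𝓘(ℝ, ℝ).prod I12) 𝓘(ℝ, ℝ) m fun q : ℝ × S1S2 =>
      q.1 * (q.2.2 : EuclideanSpace ℝ (Fin 3)) i := contMDiff_fst.mul h5
  have h6 := (contMDiff_circleExp (m := m)).comp h3
  have h7 : ContMDiff (𝓘(ℝ, ℝ).prod I12) (𝓡 1) m fun q : ℝ × S1S2 => q.2.1 :=
    contMDiff_fst.comp contMDiff_snd
  have : ContMDiffMul (𝓡 1) m Circle := .of_le le_top
  have := h6.mul h7
  exact this

theorem contMDiff_frameFlow_snd (i : Fin 3) {m : WithTop ℕ∞} :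
    ContMDiff (𝓘(ℝ, ℝ).prod I12) (𝓡 2) m fun q : ℝ × S1S2 => (frameFlow i q).2 := by
  have h : ContMDiff (𝓘(ℝ, ℝ).prod I12) (𝓘(ℝ, ℝ).prod (𝓡 2)) m fun q : ℝ × S1S2 =>
    (q.1, q.2.2) := contMDiff_fst.prodMk contMDiff_snd_snd
  have := (contMDiff_rotateS2 i (m := m)).comp h
  exact this

theorem contMDiff_frameFlow (i : Fin 3) {m : WithTop ℕ∞} :
    ContMDiff (𝓘(ℝ, ℝ).prod I12) I12 m (frameFlow i) :=
  (contMDiff_frameFlow_fst i).prodMk (contMDiff_frameFlow_snd i)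

theorem frameFlow_zero (i : Fin 3) (x : S1S2) : frameFlow i (0, x) = x :=
  Prod.ext (by simp [frameFlow]) (Subtype.ext (rotation_zero i _))

theorem hasDerivAt_incl_frameFlow (i : Fin 3) (x : S1S2) :
    HasDerivAt (fun t => incl (frameFlow i (t, x))) (ambientFrame i (incl x)) 0 := by
  have h := hasDerivAt_rotation i (x.2 : EuclideanSpace ℝ (Fin 3)) 0
  rw [rotation_zero, rotationField_apply] at h
  refine HasDerivAt.prodMk ?_ h
  have h2 := (((((hasDerivAt_id (0 : ℝ)).mul_const
    ((x.2 : EuclideanSpace ℝ (Fin 3)) i)).ofReal_comp).mul_const Complex.I).cexp).mul_const (x.1 : ℂ)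
  refine h2.congr_deriv ?_
  simp [incl]
  ring

theorem isSmoothVField_frame (i : Fin 3) : IsSmoothVField (frame i) := by
  have hs : ContMDiff I12 (𝓘(ℝ, ℝ).prod I12).tangent ∞ fun x : S1S2 =>
      (equivTangentBundleProd 𝓘(ℝ, ℝ) ℝ I12 S1S2).symm
        ((⟨0, (1 : ℝ)⟩ : TangentBundle 𝓘(ℝ, ℝ) ℝ),
          (⟨x, 0⟩ : TangentBundle I12 S1S2)) :=
    contMDiff_equivTangentBundleProd_symm.comp (contMDiff_const.prodMk
      (Bundle.contMDiff_zeroSection ℝ (TangentSpace I12 (M := S1S2))))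
  have ht := ((contMDiff_frameFlow i (m := ∞)).contMDiff_tangentMap (m := ∞) le_rfl).comp hs
  refine ht.congr fun x => ?_
  have hw (w : TangentBundle I12 S1S2) (hx : w.proj = x)
      (h : mvfderiv I12 incl w.proj w.snd = ambientFrame i (incl x)) :
      (⟨x, frame i x⟩ : TangentBundle I12 S1S2) = w := by
    obtain ⟨y, u⟩ := w
    subst hx
    exact congrArg _ (mvfderiv_incl_injective y ((mvfderiv_incl_frame i y).trans h.symm))
  refine hw _ (frameFlow_zero i x) ?_
  have hc : HasMFDerivAt 𝓘(ℝ, ℝ) (𝓘(ℝ, ℝ).prod I12) (fun t : ℝ => (t, x)) 0 _ :=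
    (hasMFDerivAt_id (I := 𝓘(ℝ, ℝ)) (0 : ℝ)).prodMk (hasMFDerivAt_const x 0)
  have hf := ((contMDiff_frameFlow i (m := 1)).mdifferentiableAt one_ne_zero
    (x := (0, x))).hasMFDerivAt
  have hi := ((contMDiff_incl (m := 1)).mdifferentiableAt one_ne_zero
    (x := frameFlow i (0, x))).hasMFDerivAt
  have h := hi.comp (0 : ℝ) (hf.comp (0 : ℝ) hc)
  have hF : HasFDerivAt (𝕜 := ℝ) (E := ℝ) (F := Ambient)
      (fun t => incl (frameFlow i (t, x))) _ 0 := h.hasFDerivAt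
  exact hF.hasDerivAt.unique (hasDerivAt_incl_frameFlow i x)

/-! ### Integration of derivatives along periodic measure preserving flows -/

section Flow

open MeasureTheory

theorem integral_deriv_along_flow_eq_zero {X : Type*} [TopologicalSpace X] [CompactSpace X]
    [SecondCountableTopology X] [MeasurableSpace X] [BorelSpace X] (μ : Measure X)
    [IsFiniteMeasure μ] {Φ : ℝ → X → X} (hΦ : Continuous (Function.uncurry Φ))
    (hμ : ∀ t, MeasurePreserving (Φ t) μ μ) {T : ℝ} (hT : 0 < T) (hper : ∀ x, Φ T x = Φ 0 x)
    {g h : X → ℝ} (hh : Continuous h)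
    (hd : ∀ x t, HasDerivAt (fun t => g (Φ t x)) (h (Φ t x)) t) : ∫ x, h x ∂μ = 0 := by
  have hc : Continuous fun q : ℝ × X => h (Φ q.1 q.2) := hh.comp hΦ
  have h1 (x : X) : ∫ t in Ioc 0 T, h (Φ t x) = 0 := by
    have hcx : Continuous fun t => h (Φ t x) := hc.comp (by fun_prop : Continuous fun t => (t, x))
    rw [← intervalIntegral.integral_of_le hT.le,
      intervalIntegral.integral_eq_sub_of_hasDerivAt (fun t _ => hd x t)
        (hcx.intervalIntegrable _ _), hper, sub_self]
  have h2 (t : ℝ) : ∫ x, h (Φ t x) ∂μ = ∫ x, h x ∂μ := by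
    conv_rhs => rw [← (hμ t).map_eq]
    exact (integral_map (hμ t).measurable.aemeasurable hh.aestronglyMeasurable).symm
  obtain ⟨C, hC⟩ := (isCompact_range hh).isBounded.exists_norm_le
  have hint : Integrable (Function.uncurry fun (x : X) (t : ℝ) => h (Φ t x))
      (μ.prod (volume.restrict (Ioc 0 T))) :=
    Integrable.of_bound (hc.comp continuous_swap).aestronglyMeasurable C
      (.of_forall fun q => hC _ ⟨_, rfl⟩)
  have h3 := integral_integral_swap hint
  simp only [h1, h2, integral_zero, integral_const, smul_eq_mul] at h3
  simpa [hT.ne', hT.le] using h3.symm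

end Flow

section Measure

open MeasureTheory

theorem measurePreserving_toSphere {E : Type*} [NormedAddCommGroup E] [InnerProductSpace ℝ E]
    [FiniteDimensional ℝ E] [MeasurableSpace E] [BorelSpace E] (φ : E ≃ₗᵢ[ℝ] E)
    {R : sphere (0 : E) 1 → sphere (0 : E) 1} (hR : ∀ y, (R y : E) = φ y) :
    MeasurePreserving R (volume : Measure E).toSphere (volume : Measure E).toSphere := by
  have hc : Continuous R := by
    refine continuous_induced_rng.2 ?_
    have : Subtype.val ∘ R = fun y : sphere (0 : E) 1 => φ y := funext hR
    rw [this]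
    fun_prop
  refine ⟨hc.measurable, Measure.ext fun s hs => ?_⟩
  rw [Measure.map_apply hc.measurable hs, Measure.toSphere_apply' _ (hc.measurable hs),
    Measure.toSphere_apply' _ hs]
  congr 1
  open Pointwise in
  have h : (Ioo (0 : ℝ) 1 • (Subtype.val '' (R ⁻¹' s)) : Set E) = 
      φ ⁻¹' (Ioo (0 : ℝ) 1 • (Subtype.val '' s)) := by
    ext v
    simp only [Set.mem_smul, mem_preimage, mem_image]
    constructor
    · rintro ⟨r, hr, _, ⟨y, hy, rfl⟩, rfl⟩
      exact ⟨r, hr, _, ⟨R y, hy, rfl⟩, by rw [hR, map_smul]⟩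
    · rintro ⟨r, hr, _, ⟨y, hy, rfl⟩, hv⟩
      have hn : φ.symm (y : E) ∈ sphere (0 : E) 1 := by simp
      refine ⟨r, hr, _, ⟨⟨φ.symm y, hn⟩, ?_, rfl⟩, ?_⟩
      · have : R ⟨φ.symm y, hn⟩ = y := Subtype.ext (by rw [hR]; simp)
        rwa [this]
      · apply φ.injective
        rw [map_smul, ← hv]
        simp
  rw [h]
  exact φ.measurePreserving.measure_preimage_emb φ.toHomeomorph.measurableEmbedding _

instance measurableSpaceCircle : MeasurableSpace Circle := borel Circle

instance borelSpaceCircle : BorelSpace Circle := ⟨rfl⟩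

instance secondCountableTopologyCircle : SecondCountableTopology Circle :=
  inferInstanceAs (SecondCountableTopology (sphere (0 : ℂ) 1))

/-- The product of the Haar measure of `S¹` and the standard measure of `S²`. -/
def stdMeasure : Measure S1S2 :=
  (Measure.haar : Measure Circle).prod (volume : Measure (EuclideanSpace ℝ (Fin 3))).toSphere

instance isFiniteMeasure_stdMeasure : IsFiniteMeasure stdMeasure := by
  unfold stdMeasure
  infer_instance

instance isOpenPosMeasure_stdMeasure : stdMeasure.IsOpenPosMeasure := by
  unfold stdMeasure
  infer_instance

theorem measurePreserving_rotateS2 (i : Fin 3) (t : ℝ) :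
    MeasurePreserving (fun p : S1S2 => (p.1, rotateS2 i t p.2)) stdMeasure stdMeasure :=
  (MeasurePreserving.id _).prod (measurePreserving_toSphere
    ((rotation i t).toLinearIsometryEquiv rfl) fun _ => rfl)

theorem measurePreserving_circle_mul (z : Circle) :
    MeasurePreserving (fun p : S1S2 => (z * p.1, p.2)) stdMeasure stdMeasure :=
  (measurePreserving_mul_left _ z).prod (MeasurePreserving.id _)

end Measure

/-! ### Extension of functions to a neighbourhood of `S¹ × S²` -/

/-- The complement of the zero sections in `ℂ × ℝ³`. -/
def nonzeroSet : TopologicalSpace.Opens Ambient where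
  carrier := {q | q.1 ≠ 0 ∧ q.2 ≠ 0}
  is_open' := (isOpen_ne_fun continuous_fst continuous_const).inter
    (isOpen_ne_fun continuous_snd continuous_const)

theorem incl_mem_nonzeroSet (p : S1S2) : incl p ∈ nonzeroSet :=
  ⟨Circle.coe_ne_zero p.1, ne_zero_of_mem_unit_sphere p.2⟩

theorem normalize_fst_mem (q : nonzeroSet) :
    ‖(q : Ambient).1‖⁻¹ • (q : Ambient).1 ∈ sphere (0 : ℂ) 1 := by
  have h := norm_ne_zero_iff.2 q.2.1
  rw [mem_sphere_zero_iff_norm, norm_smul, norm_inv, norm_norm, inv_mul_cancel₀ h]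

theorem normalize_snd_mem (q : nonzeroSet) :
    ‖(q : Ambient).2‖⁻¹ • (q : Ambient).2 ∈ sphere (0 : EuclideanSpace ℝ (Fin 3)) 1 := by
  have h := norm_ne_zero_iff.2 q.2.2
  rw [mem_sphere_zero_iff_norm, norm_smul, norm_inv, norm_norm, inv_mul_cancel₀ h]

/-- The radial projection onto `S¹ × S²`. -/
def radialProj (q : nonzeroSet) : S1S2 :=
  ((⟨‖(q : Ambient).1‖⁻¹ • (q : Ambient).1, normalize_fst_mem q⟩ : sphere (0 : ℂ) 1),
    ⟨‖(q : Ambient).2‖⁻¹ • (q : Ambient).2, normalize_snd_mem q⟩)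

theorem radialProj_incl (p : S1S2) : radialProj ⟨incl p, incl_mem_nonzeroSet p⟩ = p := by
  refine Prod.ext (Subtype.ext ?_) (Subtype.ext ?_)
  · simp [radialProj, incl, Circle.norm_coe]
  · simp [radialProj, incl]

theorem contMDiff_normalize_fst :
    ContMDiff 𝓘(ℝ, Ambient) 𝓘(ℝ, ℂ) ∞
      fun q : nonzeroSet => ‖(q : Ambient).1‖⁻¹ • (q : Ambient).1 := by
  intro q
  have h : ContDiffAt ℝ ∞ (fun x : Ambient => ‖x.1‖⁻¹ • x.1) (q : Ambient) :=
    ((contDiffAt_fst.norm ℝ q.2.1).inv (norm_ne_zero_iff.2 q.2.1)).smul contDiffAt_fst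
  exact contMDiffAt_subtype_iff.2 h.contMDiffAt

theorem contMDiff_normalize_snd :
    ContMDiff 𝓘(ℝ, Ambient) 𝓘(ℝ, EuclideanSpace ℝ (Fin 3)) ∞
      fun q : nonzeroSet => ‖(q : Ambient).2‖⁻¹ • (q : Ambient).2 := by
  intro q
  have h : ContDiffAt ℝ ∞ (fun x : Ambient => ‖x.2‖⁻¹ • x.2) (q : Ambient) :=
    ((contDiffAt_snd.norm ℝ q.2.2).inv (norm_ne_zero_iff.2 q.2.2)).smul contDiffAt_snd
  exact contMDiffAt_subtype_iff.2 h.contMDiffAt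

theorem contMDiff_radialProj : ContMDiff 𝓘(ℝ, Ambient) I12 ∞ radialProj := by
  have h1 : ContMDiff 𝓘(ℝ, Ambient) (𝓡 1) ∞ fun q : nonzeroSet => (radialProj q).1 :=
    contMDiff_normalize_fst.codRestrict_sphere (n := 1) normalize_fst_mem
  have h2 : ContMDiff 𝓘(ℝ, Ambient) (𝓡 2) ∞ fun q : nonzeroSet => (radialProj q).2 :=
    contMDiff_normalize_snd.codRestrict_sphere (n := 2) normalize_snd_mem
  exact h1.prodMk h2

open Classical in
/-- The extension of a function on `S¹ × S²` that is constant along rays. -/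
def radialExt {W : Type*} [Zero W] (f : S1S2 → W) (q : Ambient) : W :=
  if h : q ∈ nonzeroSet then f (radialProj ⟨q, h⟩) else 0

theorem radialExt_incl {W : Type*} [Zero W] (f : S1S2 → W) (p : S1S2) :
    radialExt f (incl p) = f p := by
  rw [radialExt, dif_pos (incl_mem_nonzeroSet p), radialProj_incl]

theorem contDiffOn_radialExt {W : Type*} [NormedAddCommGroup W] [NormedSpace ℝ W] {f : S1S2 → W}
    (hf : ContMDiff I12 𝓘(ℝ, W) ∞ f) : ContDiffOn ℝ ∞ (radialExt f) nonzeroSet := by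
  intro q hq
  have h := (hf.comp contMDiff_radialProj) ⟨q, hq⟩
  have he : f ∘ radialProj = fun x : nonzeroSet => radialExt f x := by
    funext x
    rw [radialExt, dif_pos x.2]
    rfl
  rw [he] at h
  exact (contMDiffAt_subtype_iff.1 h).contDiffAt.contDiffWithinAt

/-! ### Derivatives along linear vector fields -/

section LieDerivative

variable {V : Type*} [NormedAddCommGroup V] [NormedSpace ℝ V]
  {W : Type*} [NormedAddCommGroup W] [NormedSpace ℝ W]

/-- The derivative of `F` along the linear vector field `q ↦ A q`. -/
def lieD (A : V →L[ℝ] V) (F : V → W) (q : V) : W := fderiv ℝ F q (A q)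

theorem contDiffOn_lieD {s : Set V} (hs : IsOpen s) (A : V →L[ℝ] V) {F : V → W}
    (hF : ContDiffOn ℝ ∞ F s) : ContDiffOn ℝ ∞ (lieD A F) s :=
  (hF.fderiv_of_isOpen hs (by simp)).clm_apply A.contDiff.contDiffOn

theorem lieD_lieD_sub {A B : V →L[ℝ] V} {F : V → W} {q : V} (hF : ContDiffAt ℝ ∞ F q) :
    lieD A (lieD B F) q - lieD B (lieD A F) q = fderiv ℝ F q (B (A q) - A (B q)) := by
  have h2 : ContDiffAt ℝ 2 F q := hF.of_le (WithTop.coe_le_coe.2 le_top)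
  have hd : DifferentiableAt ℝ (fderiv ℝ F) q :=
    (h2.fderiv_right (m := 1) le_rfl).differentiableAt one_ne_zero
  have h (A B : V →L[ℝ] V) : lieD A (lieD B F) q =
      fderiv ℝ (fderiv ℝ F) q (A q) (B q) + fderiv ℝ F q (B (A q)) := by
    have h1 := hd.hasFDerivAt.clm_apply B.hasFDerivAt
    refine (congrArg (fun l : V →L[ℝ] W => l (A q)) h1.fderiv).trans ?_
    simp [add_comm]
  have hs := (h2.isSymmSndFDerivAt (by simp)).eq (A q) (B q)
  rw [h, h, hs, map_sub]
  abel

theorem lieD_mul {W : Type*} [NormedRing W] [NormedAlgebra ℝ W] (A : V →L[ℝ] V) {F G : V → W}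
    {q : V} (hF : DifferentiableAt ℝ F q) (hG : DifferentiableAt ℝ G q) :
    lieD A (fun x => F x * G x) q = lieD A F q * G q + F q * lieD A G q := by
  simp [lieD, fderiv_fun_mul' hF hG, add_comm]

theorem lieD_const_mul {W : Type*} [NormedRing W] [NormedAlgebra ℝ W] (A : V →L[ℝ] V) (c : W)
    {G : V → W} {q : V} (hG : DifferentiableAt ℝ G q) :
    lieD A (fun x => c * G x) q = c * lieD A G q := by
  simp [lieD, fderiv_const_mul hG]

theorem lieD_inner {W : Type*} [NormedAddCommGroup W] [InnerProductSpace ℝ W] (A : V →L[ℝ] V)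
    {F G : V → W} {q : V} (hF : DifferentiableAt ℝ F q) (hG : DifferentiableAt ℝ G q) :
    lieD A (fun x => inner ℝ (F x) (G x)) q =
      inner ℝ (lieD A F q) (G q) + inner ℝ (F q) (lieD A G q) := by
  simp [lieD, fderiv_inner_apply ℝ hF hG, add_comm]

theorem lieD_sum {ι : Type*} (s : Finset ι) (A : V →L[ℝ] V) {F : ι → V → W} {q : V}
    (hF : ∀ i ∈ s, DifferentiableAt ℝ (F i) q) :
    lieD A (fun x => ∑ i ∈ s, F i x) q = ∑ i ∈ s, lieD A (F i) q := by
  simp [lieD, fderiv_fun_sum hF]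

end LieDerivative

/-- The field `∂_θ` on `ℂ × ℝ³`. -/
def thetaField : Ambient →L[ℝ] Ambient :=
  (ContinuousLinearMap.inl ℝ ℂ (EuclideanSpace ℝ (Fin 3))).comp
    ((ContinuousLinearMap.mul ℝ ℂ Complex.I).comp (ContinuousLinearMap.fst ℝ _ _))

/-- The infinitesimal rotations of the second factor of `ℂ × ℝ³`. -/
def rotField (i : Fin 3) : Ambient →L[ℝ] Ambient :=
  (ContinuousLinearMap.inr ℝ ℂ (EuclideanSpace ℝ (Fin 3))).comp
    ((rotationField i).comp (ContinuousLinearMap.snd ℝ _ _))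

theorem thetaField_apply (q : Ambient) : thetaField q = (Complex.I * q.1, 0) := by
  simp [thetaField]

theorem rotField_apply (i : Fin 3) (q : Ambient) : rotField i q = (0, rotationField i q.2) := by
  simp [rotField]

theorem ambientFrame_eq (i : Fin 3) (q : Ambient) :
    ambientFrame i q = q.2 i • thetaField q + rotField i q := by
  rw [thetaField_apply, rotField_apply, rotationField_apply]
  simp [ambientFrame]

theorem rotField_commutator (i : Fin 3) (q : Ambient) :
    rotField (i + 1) (rotField i q) - rotField i (rotField (i + 1) q) = - rotField (i + 2) q := by
  simp only [rotField_apply]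
  refine Prod.ext (by simp) ?_
  ext j
  simp only [rotationField_apply]
  fin_cases i <;> fin_cases j <;> simp

theorem thetaField_rotField_comm (i : Fin 3) (q : Ambient) :
    thetaField (rotField i q) - rotField i (thetaField q) = 0 := by
  simp [rotField_apply, thetaField_apply]

theorem sum_smul_rotField (q : Ambient) : ∑ i, q.2 i • rotField i q = 0 := by
  simp only [Fin.sum_univ_three, rotField_apply]
  refine Prod.ext (by simp) ?_
  ext j
  simp only [rotationField_apply]
  fin_cases j <;> simp <;> ring

/-! ### Quaternionic identities -/

theorem inner_quaternion (a b : ℍ[ℝ]) : inner ℝ a b =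
    a.re * b.re + a.imI * b.imI + a.imJ * b.imJ + a.imK * b.imK := by
  rw [Quaternion.inner_def]
  simp

theorem imUnit_zero : imUnit 0 = ⟨0, 1, 0, 0⟩ := rfl

theorem imUnit_one : imUnit 1 = ⟨0, 0, 1, 0⟩ := rfl

theorem imUnit_two : imUnit 2 = ⟨0, 0, 0, 1⟩ := rfl

theorem fin_three_add : ((0 : Fin 3) + 1 = 1 ∧ (0 : Fin 3) + 2 = 2) ∧
    ((1 : Fin 3) + 1 = 2 ∧ (1 : Fin 3) + 2 = 0) ∧ ((2 : Fin 3) + 1 = 0 ∧ (2 : Fin 3) + 2 = 1) := by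
  decide

set_option maxRecDepth 10000 in
theorem dirac_anticommute_identity (F t : ℍ[ℝ]) (r s : Fin 3 → ℍ[ℝ]) (y : Fin 3 → ℝ)
    (hs : ∑ i, y i • s i = 0) :
    (∑ i, (inner ℝ (imUnit i * r i) ((∑ j, y j • imUnit j) * t) +
      inner ℝ (imUnit i * F) ((y (i + 1) • imUnit (i + 2) - y (i + 2) • imUnit (i + 1)) * t +
        (∑ j, y j • imUnit j) * s i))) +
      (inner ℝ ((∑ j, y j • imUnit j) * t) (∑ i, imUnit i * r i) +
        inner ℝ ((∑ j, y j • imUnit j) * F) (∑ i, imUnit i * s i)) =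
    2 * inner ℝ ((∑ i, imUnit i * r i) + F) ((∑ j, y j • imUnit j) * t) := by
  rw [Quaternion.ext_iff] at hs
  obtain ⟨h0, h1, h2, h3⟩ := hs
  simp only [Fin.sum_univ_three, Quaternion.re_add, Quaternion.imI_add, Quaternion.imJ_add,
    Quaternion.imK_add, Quaternion.re_smul, Quaternion.imI_smul, Quaternion.imJ_smul,
    Quaternion.imK_smul, smul_eq_mul, Quaternion.re_zero, Quaternion.imI_zero, Quaternion.imJ_zero,
    Quaternion.imK_zero] at h0 h1 h2 h3
  simp only [Fin.sum_univ_three, inner_quaternion, fin_three_add, Quaternion.re_mul,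
    Quaternion.imI_mul, Quaternion.imJ_mul, Quaternion.imK_mul,
    Quaternion.re_add, Quaternion.imI_add, Quaternion.imJ_add, Quaternion.imK_add,
    Quaternion.re_sub, Quaternion.imI_sub, Quaternion.imJ_sub, Quaternion.imK_sub,
    Quaternion.re_smul, Quaternion.imI_smul, Quaternion.imJ_smul, Quaternion.imK_smul, smul_eq_mul]
  simp only [imUnit_zero, imUnit_one, imUnit_two]
  linear_combination 2 * F.re * h0 + 2 * F.imI * h1 + 2 * F.imJ * h2 + 2 * F.imK * h3

set_option maxRecDepth 10000 in
theorem dirac_weitzenboeck_identity (F : ℍ[ℝ]) (r : Fin 3 → ℍ[ℝ]) (P : Fin 3 → Fin 3 → ℍ[ℝ])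
    (hP : ∀ i, P i (i + 1) - P (i + 1) i = - r (i + 2)) :
    ∑ i, ((inner ℝ (r i) (imUnit (i + 2) * r (i + 1)) +
        inner ℝ F (imUnit (i + 2) * P i (i + 1))) -
      (inner ℝ (r (i + 1)) (imUnit (i + 2) * r i) +
        inner ℝ F (imUnit (i + 2) * P (i + 1) i))) =
    ∑ i, inner ℝ (r i) (r i) - inner ℝ (∑ i, imUnit i * r i) (∑ i, imUnit i * r i) -
      inner ℝ F (∑ i, imUnit i * r i) := by
  have hP' i : P i (i + 1) = P (i + 1) i - r (i + 2) := by
    rw [eq_sub_iff_add_eq, ← sub_eq_zero]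
    have := hP i
    rw [sub_eq_iff_eq_add] at this
    rw [this]
    abel
  simp only [hP']
  simp only [Fin.sum_univ_three, inner_quaternion, fin_three_add, Quaternion.re_mul,
    Quaternion.imI_mul, Quaternion.imJ_mul, Quaternion.imK_mul,
    Quaternion.re_add, Quaternion.imI_add, Quaternion.imJ_add, Quaternion.imK_add,
    Quaternion.re_sub, Quaternion.imI_sub, Quaternion.imJ_sub, Quaternion.imK_sub]
  simp only [imUnit_zero, imUnit_one, imUnit_two]
  ring

theorem sum_inner_self_eq (F t : ℍ[ℝ]) (r s : Fin 3 → ℍ[ℝ]) (y : Fin 3 → ℝ)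
    (P : Fin 3 → Fin 3 → ℍ[ℝ])
    (hs : ∑ i, y i • s i = 0) (hP : ∀ i, P i (i + 1) - P (i + 1) i = - r (i + 2))
    (hF : ∑ i, imUnit i * r i = - ((∑ j, y j • imUnit j) * t)) :
    ∑ i, inner ℝ (r i) (r i) =
      (∑ i, ((inner ℝ (r i) (imUnit (i + 2) * r (i + 1)) +
        inner ℝ F (imUnit (i + 2) * P i (i + 1))) -
      (inner ℝ (r (i + 1)) (imUnit (i + 2) * r i) +
        inner ℝ F (imUnit (i + 2) * P (i + 1) i)))) -
      2⁻¹ * ((∑ i, (inner ℝ (imUnit i * r i) ((∑ j, y j • imUnit j) * t) +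
      inner ℝ (imUnit i * F) ((y (i + 1) • imUnit (i + 2) - y (i + 2) • imUnit (i + 1)) * t +
        (∑ j, y j • imUnit j) * s i))) +
      (inner ℝ ((∑ j, y j • imUnit j) * t) (∑ i, imUnit i * r i) +
        inner ℝ ((∑ j, y j • imUnit j) * F) (∑ i, imUnit i * s i))) := by
  rw [dirac_anticommute_identity F t r s y hs, dirac_weitzenboeck_identity F r P hP, hF]
  simp only [inner_add_left, inner_neg_left, inner_neg_right]
  ring

/-! ### Regularity of the frame -/

section Regularity

open MeasureTheory

variable {W : Type*} [NormedAddCommGroup W] [NormedSpace ℝ W]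

theorem contDiffAt_incl {F : Ambient → W} (hF : ContDiffOn ℝ ∞ F nonzeroSet) (p : S1S2) :
    ContDiffAt ℝ ∞ F (incl p) :=
  hF.contDiffAt (nonzeroSet.isOpen.mem_nhds (incl_mem_nonzeroSet p))

theorem differentiableAt_incl {F : Ambient → W} (hF : ContDiffOn ℝ ∞ F nonzeroSet) (p : S1S2) :
    DifferentiableAt ℝ F (incl p) :=
  (contDiffAt_incl hF p).differentiableAt (by simp)

theorem continuous_incl : Continuous incl :=
  (continuous_subtype_val.comp continuous_fst).prodMk (continuous_subtype_val.comp continuous_snd)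

theorem continuous_comp_incl {F : Ambient → W} (hF : ContDiffOn ℝ ∞ F nonzeroSet) :
    Continuous fun p => F (incl p) :=
  hF.continuousOn.comp_continuous continuous_incl incl_mem_nonzeroSet

theorem hasDerivAt_comp_rotateS2 {F : Ambient → W} (hF : ContDiffOn ℝ ∞ F nonzeroSet) (i : Fin 3)
    (p : S1S2) (t : ℝ) :
    HasDerivAt (fun t => F (incl (p.1, rotateS2 i t p.2)))
      (lieD (rotField i) F (incl (p.1, rotateS2 i t p.2))) t := by
  have h : HasDerivAt (fun t => incl (p.1, rotateS2 i t p.2))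
      (rotField i (incl (p.1, rotateS2 i t p.2))) t := by
    rw [rotField_apply]
    exact (hasDerivAt_const t (p.1 : ℂ)).prodMk (hasDerivAt_rotation i p.2 t)
  exact (differentiableAt_incl hF _).hasFDerivAt.comp_hasDerivAt t h

theorem hasDerivAt_comp_circle_mul {F : Ambient → W} (hF : ContDiffOn ℝ ∞ F nonzeroSet)
    (p : S1S2) (t : ℝ) :
    HasDerivAt (fun t => F (incl (Circle.exp t * p.1, p.2)))
      (lieD thetaField F (incl (Circle.exp t * p.1, p.2))) t := by
  have h : HasDerivAt (fun t => incl (Circle.exp t * p.1, p.2))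
      (thetaField (incl (Circle.exp t * p.1, p.2))) t := by
    rw [thetaField_apply]
    refine HasDerivAt.prodMk ?_ (hasDerivAt_const t (p.2 : EuclideanSpace ℝ (Fin 3)))
    have h2 := ((((hasDerivAt_id t).ofReal_comp).mul_const Complex.I).cexp).mul_const (p.1 : ℂ)
    refine h2.congr_deriv ?_
    simp [incl, Circle.coe_exp]
    ring
  exact (differentiableAt_incl hF _).hasFDerivAt.comp_hasDerivAt t h

theorem integral_lieD_rotField {g : Ambient → ℝ} (hg : ContDiffOn ℝ ∞ g nonzeroSet) (i : Fin 3) :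
    ∫ p, lieD (rotField i) g (incl p) ∂stdMeasure = 0 := by
  refine integral_deriv_along_flow_eq_zero stdMeasure
    (Φ := fun t p => (p.1, rotateS2 i t p.2)) (g := fun p => g (incl p)) (T := 2 * Real.pi) ?_
    (measurePreserving_rotateS2 i) Real.two_pi_pos (fun p => ?_)
    (continuous_comp_incl (contDiffOn_lieD nonzeroSet.isOpen _ hg))
    (hasDerivAt_comp_rotateS2 hg i)
  · have h := (contMDiff_rotateS2 i (m := 1)).continuous
    have h2 : Continuous fun q : ℝ × S1S2 => (q.1, q.2.2) := by fun_prop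
    have h3 : Continuous fun q : ℝ × S1S2 => q.2.1 := by fun_prop
    have h4 := h3.prodMk (h.comp h2)
    exact h4
  · exact Prod.ext rfl (Subtype.ext ((rotation_two_pi i _).trans (rotation_zero i _).symm))

theorem integral_lieD_thetaField {g : Ambient → ℝ} (hg : ContDiffOn ℝ ∞ g nonzeroSet) :
    ∫ p, lieD thetaField g (incl p) ∂stdMeasure = 0 := by
  refine integral_deriv_along_flow_eq_zero stdMeasure
    (Φ := fun t p => (Circle.exp t * p.1, p.2)) (g := fun p => g (incl p)) (T := 2 * Real.pi) ?_
    (fun t => measurePreserving_circle_mul _) Real.two_pi_pos (fun p => by simp)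
    (continuous_comp_incl (contDiffOn_lieD nonzeroSet.isOpen _ hg))
    (hasDerivAt_comp_circle_mul hg)
  exact ((Circle.exp.continuous.comp continuous_fst).mul
    (continuous_fst.comp continuous_snd)).prodMk (continuous_snd.comp continuous_snd)

/-- The imaginary quaternion `y₁ 𝐢 + y₂ 𝐣 + y₃ 𝐤`. -/
def imPart : Ambient →L[ℝ] ℍ[ℝ] := ∑ j, (dy j).smulRight (imUnit j)

theorem imPart_apply (q : Ambient) : imPart q = ∑ j, q.2 j • imUnit j := by
  simp [imPart, dy_apply]

theorem imPart_thetaField (q : Ambient) : imPart (thetaField q) = 0 := by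
  simp [imPart_apply, thetaField_apply]

theorem imPart_rotField (i : Fin 3) (q : Ambient) : imPart (rotField i q) =
    q.2 (i + 1) • imUnit (i + 2) - q.2 (i + 2) • imUnit (i + 1) := by
  rw [imPart_apply, rotField_apply, rotationField_apply]
  fin_cases i <;> simp [Fin.sum_univ_three] <;> abel

theorem lieD_clm {V : Type*} [NormedAddCommGroup V] [NormedSpace ℝ V] (A : V →L[ℝ] V)
    (l : V →L[ℝ] W) (q : V) : lieD A l q = l (A q) := by
  simp [lieD]

variable {F : Ambient → ℍ[ℝ]}

theorem sum_inner_lieD_eq_divergence (hF : ContDiffOn ℝ ∞ F nonzeroSet) (p : S1S2)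
    (h : ∑ i, imUnit i * lieD (rotField i) F (incl p) =
      - (imPart (incl p) * lieD thetaField F (incl p))) :
    ∑ i, inner ℝ (lieD (rotField i) F (incl p)) (lieD (rotField i) F (incl p)) =
    (∑ i, (lieD (rotField i)
        (fun q => inner ℝ (F q) (imUnit (i + 2) * lieD (rotField (i + 1)) F q)) (incl p) -
      lieD (rotField (i + 1))
        (fun q => inner ℝ (F q) (imUnit (i + 2) * lieD (rotField i) F q)) (incl p))) -
    2⁻¹ * ((∑ i, lieD (rotField i)
        (fun q => inner ℝ (imUnit i * F q) (imPart q * lieD thetaField F q)) (incl p)) +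
      lieD thetaField (fun q => inner ℝ (imPart q * F q)
        (∑ i, imUnit i * lieD (rotField i) F q)) (incl p)) := by
  have hθ := contDiffOn_lieD nonzeroSet.isOpen thetaField hF
  have hR i := contDiffOn_lieD nonzeroSet.isOpen (rotField i) hF
  have dF := differentiableAt_incl hF p
  have dθ := differentiableAt_incl hθ p
  have dR i := differentiableAt_incl (hR i) p
  have dY : DifferentiableAt ℝ imPart (incl p) := imPart.differentiableAt
  have hcomm (i : Fin 3) : lieD thetaField (lieD (rotField i) F) (incl p) =
      lieD (rotField i) (lieD thetaField F) (incl p) := by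
    have := lieD_lieD_sub (A := rotField i) (B := thetaField) (contDiffAt_incl hF p)
    rw [thetaField_rotField_comm, map_zero, sub_eq_zero] at this
    exact this.symm
  have hP (i : Fin 3) : lieD (rotField i) (lieD (rotField (i + 1)) F) (incl p) -
      lieD (rotField (i + 1)) (lieD (rotField i) F) (incl p) =
      - lieD (rotField (i + 2)) F (incl p) := by
    rw [lieD_lieD_sub (contDiffAt_incl hF p), rotField_commutator, map_neg]
    rfl
  have hs : ∑ i, (incl p).2 i • lieD (rotField i) (lieD thetaField F) (incl p) = 0 := by
    have := congrArg (fderiv ℝ (lieD thetaField F) (incl p)) (sum_smul_rotField (incl p))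
    rw [map_sum, map_zero] at this
    simp only [map_smul] at this
    exact this
  have e1 (i j k : Fin 3) : lieD (rotField i)
      (fun q => inner ℝ (F q) (imUnit k * lieD (rotField j) F q)) (incl p) =
      inner ℝ (lieD (rotField i) F (incl p)) (imUnit k * lieD (rotField j) F (incl p)) +
      inner ℝ (F (incl p)) (imUnit k * lieD (rotField i) (lieD (rotField j) F) (incl p)) := by
    rw [lieD_inner _ dF ((dR j).const_mul _), lieD_const_mul _ _ (dR j)]
  have e2 (i : Fin 3) : lieD (rotField i)
      (fun q => inner ℝ (imUnit i * F q) (imPart q * lieD thetaField F q)) (incl p) =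
      inner ℝ (imUnit i * lieD (rotField i) F (incl p))
        (imPart (incl p) * lieD thetaField F (incl p)) +
      inner ℝ (imUnit i * F (incl p)) (imPart (rotField i (incl p)) * lieD thetaField F (incl p) +
        imPart (incl p) * lieD (rotField i) (lieD thetaField F) (incl p)) := by
    rw [lieD_inner _ (dF.const_mul _) (dY.fun_mul dθ), lieD_const_mul _ _ dF, lieD_mul _ dY dθ,
      lieD_clm]
  have e3 : lieD thetaField (fun q => inner ℝ (imPart q * F q)
        (∑ i, imUnit i * lieD (rotField i) F q)) (incl p) =
      inner ℝ (imPart (incl p) * lieD thetaField F (incl p))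
        (∑ i, imUnit i * lieD (rotField i) F (incl p)) +
      inner ℝ (imPart (incl p) * F (incl p))
        (∑ i, imUnit i * lieD (rotField i) (lieD thetaField F) (incl p)) := by
    have d i : DifferentiableAt ℝ (fun q => imUnit i * lieD (rotField i) F q) (incl p) :=
      (dR i).const_mul _
    rw [lieD_inner _ (dY.fun_mul dF) (DifferentiableAt.fun_sum fun i _ => d i), lieD_mul _ dY dF,
      lieD_clm, imPart_thetaField, zero_mul, zero_add, lieD_sum _ _ fun i _ => d i]
    simp only [lieD_const_mul _ _ (dR _), hcomm]
  simp only [e1, e2, e3, imPart_rotField]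
  simp only [imPart_apply] at h ⊢
  exact sum_inner_self_eq _ _ _ _ _ (fun i j => lieD (rotField i) (lieD (rotField j) F) (incl p))
    hs hP h

theorem lieD_rotField_eq_zero (hF : ContDiffOn ℝ ∞ F nonzeroSet)
    (h : ∀ p, ∑ i, imUnit i * lieD (rotField i) F (incl p) =
      - (imPart (incl p) * lieD thetaField F (incl p))) (p : S1S2) (i : Fin 3) :
    lieD (rotField i) F (incl p) = 0 := by
  have hθ := contDiffOn_lieD nonzeroSet.isOpen thetaField hF
  have hR i := contDiffOn_lieD nonzeroSet.isOpen (rotField i) hF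
  have hY : ContDiffOn ℝ ∞ imPart nonzeroSet := imPart.contDiff.contDiffOn
  have g1 (i k : Fin 3) : ContDiffOn ℝ ∞
      (fun q => inner ℝ (F q) (imUnit k * lieD (rotField i) F q)) nonzeroSet :=
    hF.inner ℝ (contDiffOn_const.mul (hR i))
  have g2 (i : Fin 3) : ContDiffOn ℝ ∞
      (fun q => inner ℝ (imUnit i * F q) (imPart q * lieD thetaField F q)) nonzeroSet :=
    (contDiffOn_const.mul hF).inner ℝ (hY.mul hθ)
  have g3 : ContDiffOn ℝ ∞ (fun q => inner ℝ (imPart q * F q)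
        (∑ i, imUnit i * lieD (rotField i) F q)) nonzeroSet :=
    (hY.mul hF).inner ℝ (ContDiffOn.sum fun i _ => contDiffOn_const.mul (hR i))
  have hint (A : Ambient →L[ℝ] Ambient) {g : Ambient → ℝ} (hg : ContDiffOn ℝ ∞ g nonzeroSet) :
      Integrable (fun p => lieD A g (incl p)) stdMeasure :=
    (continuous_comp_incl (contDiffOn_lieD nonzeroSet.isOpen A hg)).integrable_of_hasCompactSupport
      (HasCompactSupport.of_compactSpace _)
  have hzero : ∫ p, ∑ i, inner ℝ (lieD (rotField i) F (incl p))
      (lieD (rotField i) F (incl p)) ∂stdMeasure = 0 := by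
    simp_rw [fun p => sum_inner_lieD_eq_divergence hF p (h p)]
    have i1 : ∀ i ∈ (Finset.univ : Finset (Fin 3)), Integrable (fun p => lieD (rotField i)
        (fun q => inner ℝ (F q) (imUnit (i + 2) * lieD (rotField (i + 1)) F q)) (incl p) -
      lieD (rotField (i + 1))
        (fun q => inner ℝ (F q) (imUnit (i + 2) * lieD (rotField i) F q)) (incl p)) stdMeasure :=
      fun i _ => (hint _ (g1 _ _)).sub (hint _ (g1 _ _))
    have i2 : ∀ i ∈ (Finset.univ : Finset (Fin 3)), Integrable (fun p => lieD (rotField i)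
        (fun q => inner ℝ (imUnit i * F q) (imPart q * lieD thetaField F q)) (incl p))
        stdMeasure := fun i _ => hint _ (g2 i)
    have i3 : Integrable (fun p => (∑ i, lieD (rotField i)
        (fun q => inner ℝ (imUnit i * F q) (imPart q * lieD thetaField F q)) (incl p)) +
      lieD thetaField (fun q => inner ℝ (imPart q * F q)
        (∑ i, imUnit i * lieD (rotField i) F q)) (incl p)) stdMeasure :=
      (integrable_finsetSum _ i2).add (hint _ g3)
    rw [integral_sub (integrable_finsetSum _ i1) (i3.const_mul _), integral_finsetSum _ i1,
      integral_const_mul, integral_add (integrable_finsetSum _ i2) (hint _ g3),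
      integral_finsetSum _ i2, integral_lieD_thetaField g3]
    simp only [integral_sub (hint _ (g1 _ _)) (hint _ (g1 _ _)), integral_lieD_rotField (g1 _ _),
      integral_lieD_rotField (g2 _)]
    simp
  have hc : Continuous fun p => ∑ i, inner ℝ (lieD (rotField i) F (incl p))
      (lieD (rotField i) F (incl p)) :=
    continuous_finsetSum _ fun i _ => (continuous_comp_incl (hR i)).inner
      (continuous_comp_incl (hR i))
  have hnn : ∀ p, 0 ≤ ∑ i, inner ℝ (lieD (rotField i) F (incl p))
      (lieD (rotField i) F (incl p)) := fun p =>
    Finset.sum_nonneg fun i _ => real_inner_self_nonneg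
  have h0 := (hc.ae_eq_iff_eq stdMeasure (continuous_const (y := (0 : ℝ)))).1
    ((integral_eq_zero_iff_of_nonneg hnn
      (hc.integrable_of_hasCompactSupport (HasCompactSupport.of_compactSpace _))).1 hzero)
  have hp := congrFun h0 p
  rw [Finset.sum_eq_zero_iff_of_nonneg fun i _ => real_inner_self_nonneg] at hp
  exact inner_self_eq_zero.1 (hp i (Finset.mem_univ i))

end Regularity

section Constancy

variable {W : Type*} [NormedAddCommGroup W] [NormedSpace ℝ W]

theorem mvfderiv_eq_fderiv_radialExt {f : S1S2 → W} (hf : ContMDiff I12 𝓘(ℝ, W) ∞ f) (p : S1S2)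
    (u : TangentSpace I12 p) :
    mvfderiv I12 f p u = fderiv ℝ (radialExt f) (incl p) (mvfderiv I12 incl p u) := by
  have h1 := (differentiableAt_incl (contDiffOn_radialExt hf) p).hasFDerivAt.hasMFDerivAt
  have h2 := ((contMDiff_incl (m := 1)).mdifferentiableAt one_ne_zero (x := p)).hasMFDerivAt
  have h := h1.comp p h2
  have he : radialExt f ∘ incl = f := funext (radialExt_incl f)
  rw [he] at h
  exact congrArg (fun L => L u) h.mfderiv

theorem mvfderiv_frame {f : S1S2 → W} (hf : ContMDiff I12 𝓘(ℝ, W) ∞ f) (i : Fin 3) (p : S1S2) :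
    mvfderiv I12 f p (frame i p) = (incl p).2 i • lieD thetaField (radialExt f) (incl p) +
      lieD (rotField i) (radialExt f) (incl p) := by
  rw [mvfderiv_eq_fderiv_radialExt hf, mvfderiv_incl_frame, ambientFrame_eq, map_add, map_smul]
  rfl

theorem imPart_incl_ne_zero (p : S1S2) : imPart (incl p) ≠ 0 := by
  intro h
  have hy := sum_sq_coe_S2 p.2
  rw [imPart_apply, Quaternion.ext_iff] at h
  obtain ⟨-, h1, h2, h3⟩ := h
  simp [Fin.sum_univ_three, incl] at h1 h2 h3
  simp [imUnit_zero, imUnit_one, imUnit_two] at h1 h2 h3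
  simp [h1, h2, h3] at hy

theorem apply_rotateS2_eq {f : S1S2 → W} (hf : ContMDiff I12 𝓘(ℝ, W) ∞ f) {i : Fin 3}
    (h : ∀ p, lieD (rotField i) (radialExt f) (incl p) = 0) (t : ℝ) (p : S1S2) :
    f (p.1, rotateS2 i t p.2) = f p := by
  have hd := hasDerivAt_comp_rotateS2 (contDiffOn_radialExt hf) i p
  simp only [h, radialExt_incl] at hd
  have hc := is_const_of_deriv_eq_zero (fun t => (hd t).differentiableAt) (fun t => (hd t).deriv) t 0
  rw [hc]
  exact congrArg f (Prod.ext rfl (Subtype.ext (rotation_zero i _)))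

theorem apply_circle_mul_eq {f : S1S2 → W} (hf : ContMDiff I12 𝓘(ℝ, W) ∞ f)
    (h : ∀ p, lieD thetaField (radialExt f) (incl p) = 0) (z : Circle) (p : S1S2) :
    f (z * p.1, p.2) = f p := by
  have hd := hasDerivAt_comp_circle_mul (contDiffOn_radialExt hf) p
  simp only [h, radialExt_incl] at hd
  obtain ⟨t, rfl⟩ : ∃ t, Circle.exp t = z := ⟨_, Circle.exp_arg z⟩
  have hc := is_const_of_deriv_eq_zero (fun t => (hd t).differentiableAt) (fun t => (hd t).deriv) t 0
  simpa using hc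

theorem exists_rotateS2 (i : Fin 3) (y : S2) : ∃ t,
    (rotateS2 i t y : EuclideanSpace ℝ (Fin 3)) i = (y : EuclideanSpace ℝ (Fin 3)) i ∧
    0 ≤ (rotateS2 i t y : EuclideanSpace ℝ (Fin 3)) (i + 1) ∧
    (rotateS2 i t y : EuclideanSpace ℝ (Fin 3)) (i + 2) = 0 := by
  set w : ℂ := ⟨(y : EuclideanSpace ℝ (Fin 3)) (i + 1), (y : EuclideanSpace ℝ (Fin 3)) (i + 2)⟩
    with hw
  obtain ⟨h0, h1, h2⟩ := rotation_coord i (-w.arg) (y : EuclideanSpace ℝ (Fin 3))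
  have hc : (y : EuclideanSpace ℝ (Fin 3)) (i + 1) = ‖w‖ * Real.cos w.arg :=
    (Complex.norm_mul_cos_arg w).symm
  have hs : (y : EuclideanSpace ℝ (Fin 3)) (i + 2) = ‖w‖ * Real.sin w.arg :=
    (Complex.norm_mul_sin_arg w).symm
  refine ⟨-w.arg, h0, ?_, ?_⟩
  · refine (show (0 : ℝ) ≤ ‖w‖ from norm_nonneg w).trans_eq ?_
    change _ = rotation i (-w.arg) (y : EuclideanSpace ℝ (Fin 3)) (i + 1)
    rw [h1, hc, hs, Real.cos_neg, Real.sin_neg]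
    linear_combination -‖w‖ * Real.sin_sq_add_cos_sq w.arg
  · change rotation i (-w.arg) (y : EuclideanSpace ℝ (Fin 3)) (i + 2) = 0
    rw [h2, hc, hs, Real.cos_neg, Real.sin_neg]
    ring

theorem exists_rotateS2_rotateS2_eq (y : S2) : ∃ s t,
    (rotateS2 1 t (rotateS2 2 s y) : EuclideanSpace ℝ (Fin 3)) = EuclideanSpace.single 2 1 := by
  obtain ⟨s, -, -, hs⟩ := exists_rotateS2 2 y
  obtain ⟨t, h0, h1, h2⟩ := exists_rotateS2 1 (rotateS2 2 s y)
  refine ⟨s, t, ?_⟩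
  have hn := sum_sq_coe_S2 (rotateS2 1 t (rotateS2 2 s y))
  simp only [fin_three_add] at hs h0 h1 h2
  rw [h0, h2, hs] at hn
  have h3 : (rotateS2 1 t (rotateS2 2 s y) : EuclideanSpace ℝ (Fin 3)) 2 = 1 := by
    nlinarith
  ext j
  fin_cases j
  · simpa using h2
  · simpa [hs] using h0
  · simpa using h3

theorem eq_const_of_lieD_eq_zero {f : S1S2 → W} (hf : ContMDiff I12 𝓘(ℝ, W) ∞ f)
    (hR : ∀ i p, lieD (rotField i) (radialExt f) (incl p) = 0)
    (hθ : ∀ p, lieD thetaField (radialExt f) (incl p) = 0) : ∃ c, ∀ x, f x = c := by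
  have hn : EuclideanSpace.single 2 1 ∈ sphere (0 : EuclideanSpace ℝ (Fin 3)) 1 := by simp
  refine ⟨f (1, ⟨EuclideanSpace.single 2 1, hn⟩), fun x => ?_⟩
  obtain ⟨s, t, hst⟩ := exists_rotateS2_rotateS2_eq x.2
  rw [← apply_circle_mul_eq hf hθ x.1⁻¹ x, inv_mul_cancel,
    ← apply_rotateS2_eq hf (hR 2) s (1, x.2), ← apply_rotateS2_eq hf (hR 1) t]
  exact congrArg f (Prod.ext rfl (Subtype.ext hst))

end Constancy

theorem isDivergenceFreeFrame_frame : IsDivergenceFreeFrame vol frame where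
  smooth := isSmoothVField_frame
  divergence_free := extD_interiorProd_frame_vol
  positive p := by
    rw [vol_frame]
    exact one_pos

theorem isRegular_frame : IsRegular vol frame := by
  refine ⟨isDivergenceFreeFrame_frame, fun f hf hfueter => ?_⟩
  have h (p : S1S2) : ∑ i, imUnit i * lieD (rotField i) (radialExt f) (incl p) =
      - (imPart (incl p) * lieD thetaField (radialExt f) (incl p)) := by
    rw [eq_neg_iff_add_eq_zero, add_comm, ← hfueter p, imPart_apply, Finset.sum_mul,
      ← Finset.sum_add_distrib]
    refine Finset.sum_congr rfl fun i _ => ?_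
    rw [mvfderiv_frame hf, mul_add, smul_mul_assoc, mul_smul_comm]
  have hR := lieD_rotField_eq_zero (contDiffOn_radialExt hf) h
  refine eq_const_of_lieD_eq_zero hf (fun i p => hR p i) fun p => ?_
  have hp := h p
  simp only [hR, mul_zero, Finset.sum_const_zero, zero_eq_neg, mul_eq_zero] at hp
  exact hp.resolve_left (imPart_incl_ne_zero p)

end Fueter

end

theorem mainTheorem9 :
    Fueter.IsVolumeForm Fueter.vol ∧
      Fueter.IsDivergenceFreeFrame Fueter.vol Fueter.frame ∧
      Fueter.IsNormal Fueter.vol Fueter.frame ∧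
      Fueter.IsRegular Fueter.vol Fueter.frame :=
  ⟨Fueter.isVolumeForm_vol, Fueter.isDivergenceFreeFrame_frame,
    ⟨Fueter.isDivergenceFreeFrame_frame, Fueter.vol_frame⟩, Fueter.isRegular_frame⟩
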